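/- Lemma 4.1. Let $\log=\log_2$. There is an absolute constant $\gamma>0$ such that for every $\delta\in(0,1]$ and every integer $\Delta\ge 0$ there are $K>0$ and $d_0$, depending only on $\delta$ and $\Delta$, for which the following holds. Let $d\ge d_0$ be an integer and let $\Sigma$ be a finite bipartite graph on the bipartition $X\cup Y$ such that - $\delta d\le d(v)\le d$ for every $v\in X\cup Y$, where $d(v)$ is the degree of $v$; - $d(v)\ge d(w)$ whenever $v\in X$, $w\in Y$ and $v\sim w$; - $|N(v)\cap N(w)|\le\Delta$ for all distinct vertices $v,w$. For $A\subseteq X$ write $N(A)=\bigcup_{v\in A}N(v)$ and $[A]=\{v\in X\cup Y: N(v)\subseteq N(A)\}$, and call $A$ $2$-linked if it induces a connected (in particular non-empty) subgraph of the graph $\Sigma^2$ on $X\cup Y$ in which two distinct vertices are adjacent if and only if their distance in $\Sigma$ is at most $2$. For integers $a,g\ge 0$ let $$\mathcal G(a,g)=\{A\subseteq X: A\text{ is $2$-linked},\ |[A]|=a,\ |N(A)|=g\}.$$ If $g-a\ge K\,\dfrac{g\log^3 d}{d^2}$ and $g-a\ge K\log^2 d$, then $$|\mathcal G(a,g)|\le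 |Y|\cdot 2^{\,g-\gamma(g-a)/\log d}.$$ -/

import Mathlib

namespace GraphContainer

/-- The `k`-th power of a graph `H`: distinct vertices are adjacent iff their distance in `H`
is at most `k` (the distance of vertices in different components is infinite). -/
def power {V : Type*} (H : SimpleGraph V) (k : ℕ) : SimpleGraph V where
  Adj u v := u ≠ v ∧ H.edist u v ≤ (k : ℕ∞)
  symm := ⟨fun u v h => ⟨h.1.symm, by rw [SimpleGraph.edist_comm]; exact h.2⟩⟩
  loopless := ⟨fun _ h => h.1 rfl⟩

/-- `A` is `k`-linked in `H`: the subgraph of the `k`-th power of `H` induced by `A` is connected. -/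
def IsLinked {V : Type*} (H : SimpleGraph V) (k : ℕ) (A : Finset V) : Prop :=
  ((power H k).induce (A : Set V)).Connected

/-- The neighbourhood `N(A) = ⋃_{v ∈ A} N(v)`. -/
def nbhd {V : Type*} [Fintype V] [DecidableEq V] (H : SimpleGraph V) [DecidableRel H.Adj]
    (A : Finset V) : Finset V :=
  A.biUnion fun v => H.neighborFinset v

/-- The closure `[A] = {v ∈ V(H) : N(v) ⊆ N(A)}`. -/
def closure {V : Type*} [Fintype V] [DecidableEq V] (H : SimpleGraph V) [DecidableRel H.Adj]
    (A : Finset V) : Finset V :=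
  Finset.univ.filter fun v => H.neighborFinset v ⊆ nbhd H A

open Classical in
/-- The family of all `2`-linked `A ⊆ X` with `|[A]| = a` and `|N(A)| = g`. -/
noncomputable def family {V : Type*} [Fintype V] [DecidableEq V] (H : SimpleGraph V)
    [DecidableRel H.Adj] (X : Finset V) (a g : ℕ) : Finset (Finset V) :=
  X.powerset.filter fun A =>
    IsLinked H 2 A ∧ (closure H A).card = a ∧ (nbhd H A).card = g

end GraphContainer

/-! Write `t = g - a` and `L = log d`. Each `A` is recovered from a short code of six vertex sets.
The degree condition along edges leaves at most `t d` edges from `N(A)` to the complement of `[A]`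
(`boundary_le`), so the neighbourhood of a small random sample `T` of `N(A)` lies almost inside
`[A]`. Bounded codegrees (`card_nbhd_ge`) make two steps from `T` through `[A]` reach most of
`N(A)`. With the exceptions and two greedy families recorded, the code determines sets `S ⊇ [A]` and
`F ⊆ N(A)` with `|S| ≤ |F| + O(t/√d)` (`exists_sample`, `exists_approx`).

The code stays within distance 3 of the linked set `A`, and `A` within distance 3 of the code. Hence
its union is connected by steps of length at most 8, and there are only `|Y| 2^{O(nL)}` codes of
size `n`. The two lower bounds on `t` give `n = O(t/L²)`: the first pays for the sample, the second
for the root. So the code costs `O(t/L)` bits.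

Let `η = t/(320L)`. If `|S| ≤ g - η`, then `A` is one of `2^{g-η}` subsets of `S`. Otherwise `F`
misses at most `2η` vertices of `N(A)`; adding them to the code costs `t/4` bits and reveals `[A]`,
which has only `2^{g-t}` subsets. -/

namespace GraphContainer

open Finset

/-! ### Averaging and greedy exhaustion. -/

/-- Random sampling made deterministic: if every `u ∈ U` is related to at least a proportion `q` of
`P`, then `m` points of `P` can be chosen so that their total cost plus the number of points of `U`
that they miss is at most its average value. -/
theorem exists_cheap_cover {α β : Type*} [DecidableEq α] (P : Finset α) (hP : P.Nonempty) (x : α → ℝ)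
    (hx : ∀ w, 0 ≤ x w) (R : β → α → Prop) [∀ u w, Decidable (R u w)] (q : ℝ) (hq : q ≤ 1) (m : ℕ) (U : Finset β)
    (hU : ∀ u ∈ U, q * (P.card : ℝ) ≤ ((P.filter (R u)).card : ℝ)) :
    ∃ T ⊆ P, T.card ≤ m ∧
      ∑ w ∈ T, x w + ((U.filter fun u => ∀ w ∈ T, ¬ R u w).card : ℝ) ≤
        m * ((∑ w ∈ P, x w) / P.card) + U.card * (1 - q) ^ m := by
  have hP0 : (0 : ℝ) < P.card := by exact_mod_cast hP.card_pos
  induction m generalizing U with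
  | zero => exact ⟨∅, by simp, by simp, by simp⟩
  | succ m ih =>
    set c : ℝ := (1 - q) ^ m with hc
    have hc0 : 0 ≤ c := pow_nonneg (by linarith) m
    -- One point is chosen by averaging its cost plus the misses expected after `m` further points;
    -- the factor `c` prices a point of `U` still missed.
    obtain ⟨w, hw, hle⟩ : ∃ w ∈ P,
        x w + ((U.filter fun u => ¬ R u w).card : ℝ) * c ≤
          (∑ w ∈ P, x w) / P.card + U.card * (1 - q) * c := by
      apply Finset.exists_le_of_sum_le hP
      rw [Finset.sum_add_distrib, ← Finset.sum_mul, Finset.sum_const, nsmul_eq_mul, mul_add,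
        mul_div_cancel₀ _ hP0.ne']
      refine add_le_add le_rfl ?_
      have h1 : ∑ w ∈ P, ((U.filter fun u => ¬ R u w).card : ℝ) =
          ∑ u ∈ U, ((P.filter fun w => ¬ R u w).card : ℝ) := by
        exact_mod_cast Finset.sum_card_bipartiteAbove_eq_sum_card_bipartiteBelow
          (s := P) (t := U) (fun w u => ¬ R u w)
      rw [h1]
      have h2 : ∀ u ∈ U, ((P.filter fun w => ¬ R u w).card : ℝ) ≤ (1 - q) * P.card := by
        intro u hu
        have h3 := Finset.card_filter_add_card_filter_not (s := P) (R u)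
        have h4 : ((P.filter (R u)).card : ℝ) + ((P.filter fun w => ¬ R u w).card : ℝ) = P.card := by
          exact_mod_cast h3
        have := hU u hu
        linarith
      calc (∑ u ∈ U, ((P.filter fun w => ¬ R u w).card : ℝ)) * c
          ≤ (∑ u ∈ U, (1 - q) * P.card) * c := by gcongr with u hu; exact h2 u hu
        _ = P.card * (U.card * (1 - q) * c) := by
          rw [Finset.sum_const, nsmul_eq_mul]; ring
    obtain ⟨T, hTP, hTm, hT⟩ := ih (U.filter fun u => ¬ R u w)
      (fun u hu => hU u (Finset.mem_filter.1 hu).1)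
    refine ⟨insert w T, Finset.insert_subset hw hTP,
      (Finset.card_insert_le _ _).trans (by omega), ?_⟩
    have h5 : ∑ v ∈ insert w T, x v ≤ x w + ∑ v ∈ T, x v := by
      by_cases h : w ∈ T
      · rw [Finset.insert_eq_of_mem h]; linarith [hx w]
      · rw [Finset.sum_insert h]
    have h6 : (U.filter fun u => ∀ v ∈ insert w T, ¬ R u v) =
        (U.filter fun u => ¬ R u w).filter fun u => ∀ v ∈ T, ¬ R u v := by
      ext u; simp [and_assoc]
    rw [h6, pow_succ]
    push_cast
    nlinarith

/-- A maximal subfamily each member of which covers, on average, at least `ψ` points outside `E`. -/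
theorem exists_exhausting {α β : Type*} [DecidableEq α] [DecidableEq β] (P : Finset α)
    (N : α → Finset β) (E : Finset β) (ψ : ℝ) (hψ : 0 < ψ) :
    ∃ U ⊆ P, ψ * (U.card : ℝ) ≤ ((U.biUnion N \ E).card : ℝ) ∧
      ∀ u ∈ P, ((N u \ (E ∪ U.biUnion N)).card : ℝ) < ψ := by
  classical
  obtain ⟨U, hU, hmax⟩ := Finset.exists_max_image
    (P.powerset.filter fun U => ψ * (U.card : ℝ) ≤ ((U.biUnion N \ E).card : ℝ))
    Finset.card ⟨∅, by simp⟩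
  rw [Finset.mem_filter, Finset.mem_powerset] at hU
  refine ⟨U, hU.1, hU.2, fun u hu => ?_⟩
  by_contra! hge
  have huU : u ∉ U := by
    intro h
    have : N u \ (E ∪ U.biUnion N) = ∅ := by
      rw [Finset.sdiff_eq_empty_iff_subset]
      exact (Finset.subset_biUnion_of_mem N h).trans Finset.subset_union_right
    rw [this] at hge
    simp at hge
    linarith
  have hcard : ((insert u U).biUnion N \ E).card =
      (U.biUnion N \ E).card + (N u \ (E ∪ U.biUnion N)).card := by
    rw [← Finset.card_union_of_disjoint]
    · congr 1; ext b; simp only [mem_sdiff, mem_biUnion, mem_insert, mem_union]; grind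
    · rw [Finset.disjoint_left]; intro b; simp only [mem_sdiff, mem_union]; grind
  have := hmax (insert u U) (by
    rw [Finset.mem_filter, Finset.mem_powerset]
    refine ⟨Finset.insert_subset hu hU.1, ?_⟩
    rw [hcard, Finset.card_insert_of_notMem huU]
    push_cast
    linarith [hU.2])
  rw [Finset.card_insert_of_notMem huU] at this
  omega

/-! ### Counting connected sets by tours. -/

section Tours

variable {V : Type*} [DecidableEq V]

/-- The lists `r = x₀, x₁, …, xₙ` in which every `xᵢ₊₁` belongs to `B xᵢ`. -/
def tours (B : V → Finset V) : ℕ → V → Finset (List V)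
  | 0, r => {[r]}
  | n + 1, r => (B r).biUnion fun v => (tours B n v).image (r :: ·)

theorem card_tours_le {B : V → Finset V} {D : ℕ} (hB : ∀ v, (B v).card ≤ D) (n : ℕ) (r : V) :
    (tours B n r).card ≤ D ^ n := by
  induction n generalizing r with
  | zero => simp [tours]
  | succ n ih =>
    rw [tours, pow_succ']
    refine (Finset.card_biUnion_le_card_mul _ _ (D ^ n) fun v _ =>
      Finset.card_image_le.trans (ih v)).trans (Nat.mul_le_mul_right _ (hB r))

theorem mem_tours {B : V → Finset V} {l : List V} {r : V}
    (h : (r :: l).IsChain fun a b => b ∈ B a) : r :: l ∈ tours B l.length r := by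
  induction l generalizing r with
  | nil => simp [tours]
  | cons a l ih =>
    rw [List.isChain_cons_cons] at h
    simp only [tours, List.length_cons, mem_biUnion, mem_image]
    exact ⟨a, h.1, _, ih h.2, rfl⟩

/-- `W` cannot be split, with `r` on one side, into two parts with no step of `B` between them. -/
def Unsplit (B : V → Finset V) (r : V) (W : Finset V) : Prop :=
  r ∈ W ∧ ∀ P ⊂ W, r ∈ P → ∃ u ∈ P, ∃ v ∈ W \ P, v ∈ B u

/-- Take a largest subset of `W` that has a tour. If it is not `W`, some step leads from a visited
`u` to an unvisited `v`, and the detour `u, v, u` adds one vertex and two steps. -/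
theorem Unsplit.exists_tour {B : V → Finset V} (hsymm : ∀ u v, v ∈ B u → u ∈ B v) {r : V}
    {W : Finset V} (h : Unsplit B r W) :
    ∃ l : List V, (r :: l).IsChain (fun a b => b ∈ B a) ∧ (r :: l).toFinset = W ∧
      l.length + 2 = 2 * W.card := by
  classical
  obtain ⟨P, hP, hmax⟩ := Finset.exists_max_image
    (W.powerset.filter fun P => ∃ l : List V, (r :: l).IsChain (fun a b => b ∈ B a) ∧
      (r :: l).toFinset = P ∧ l.length + 2 = 2 * P.card) Finset.card
    ⟨{r}, by
      rw [Finset.mem_filter, Finset.mem_powerset]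
      exact ⟨by simpa using h.1, [], by simp, by simp, by simp⟩⟩
  rw [Finset.mem_filter, Finset.mem_powerset] at hP
  obtain ⟨hPW, l, hch, hl, hlen⟩ := hP
  rcases hPW.eq_or_ssubset with rfl | hss
  · exact ⟨l, hch, hl, hlen⟩
  obtain ⟨u, hu, v, hv, huv⟩ := h.2 P hss (by rw [← hl]; simp)
  rw [mem_sdiff] at hv
  rw [← hl, List.mem_toFinset] at hu
  obtain ⟨s, t, hst⟩ := List.append_of_mem hu
  -- The detour goes in at one occurrence of `u`; the cases check that the list still starts at `r`.
  obtain ⟨l', hl'⟩ : ∃ l', s ++ u :: v :: u :: t = r :: l' := by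
    cases s with
    | nil =>
      simp only [List.nil_append, List.cons.injEq] at hst
      exact ⟨v :: u :: t, by simp [hst.1]⟩
    | cons a s =>
      simp only [List.cons_append, List.cons.injEq] at hst
      exact ⟨s ++ u :: v :: u :: t, by simp [hst.1]⟩
  have hlen' : l'.length = l.length + 2 := by
    have h1 := congrArg List.length hst
    have h2 := congrArg List.length hl'
    simp at h1 h2
    omega
  have hset : (r :: l').toFinset = insert v P := by
    rw [← hl', ← hl, hst]
    ext z
    simp only [List.mem_toFinset, List.mem_append, List.mem_cons, mem_insert]
    grind
  have hcard : (insert v P).card = P.card + 1 := Finset.card_insert_of_notMem hv.2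
  have hch' : (r :: l').IsChain (fun a b => b ∈ B a) := by
    rw [hst] at hch
    rw [← hl']
    rw [List.isChain_append] at hch ⊢
    refine ⟨hch.1, ?_, by simpa using hch.2.2⟩
    rw [List.isChain_cons_cons, List.isChain_cons_cons]
    exact ⟨huv, hsymm _ _ huv, hch.2.1⟩
  have := hmax (insert v P) (by
    rw [Finset.mem_filter, Finset.mem_powerset]
    exact ⟨Finset.insert_subset hv.1 hPW, l', hch', hset, by omega⟩)
  omega

open Classical in
/-- The number of unsplit sets of bounded size that contain a given vertex. -/
theorem card_unsplit_le [Fintype V] {B : V → Finset V} (hrefl : ∀ v, v ∈ B v)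
    (hsymm : ∀ u v, v ∈ B u → u ∈ B v) {D : ℕ} (hB : ∀ v, (B v).card ≤ D) (r : V) (n : ℕ) :
    ((univ : Finset (Finset V)).filter fun W => Unsplit B r W ∧ W.card ≤ n).card ≤
      D ^ (2 * n) := by
  refine le_trans (Finset.card_le_card ?_)
    ((Finset.card_image_le (f := List.toFinset)).trans (card_tours_le hB (2 * n) r))
  intro W hW
  obtain ⟨hW, hn⟩ := (Finset.mem_filter.1 hW).2
  obtain ⟨l, hch, hl, hlen⟩ := hW.exists_tour hsymm
  -- Idling at `r` pads every tour to exactly `2 * n` steps, so that a single length has to be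
  -- counted.
  have key : ∀ k : ℕ, (r :: (List.replicate k r ++ l)).IsChain (fun a b => b ∈ B a) := by
    intro k
    induction k with
    | zero => simpa using hch
    | succ k ih =>
      rw [List.replicate_succ, List.cons_append, List.isChain_cons_cons]
      exact ⟨hrefl r, ih⟩
  refine Finset.mem_image.2 ⟨r :: (List.replicate (2 * n - l.length) r ++ l), ?_, ?_⟩
  · have := mem_tours (key (2 * n - l.length))
    have hlen' : (List.replicate (2 * n - l.length) r ++ l).length = 2 * n := by
      simp; omega
    rwa [hlen'] at this
  · rw [← hl]
    ext z
    simp only [List.mem_toFinset, List.mem_append, List.mem_cons, List.mem_replicate]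
    tauto

end Tours

/-! ### Balls in a graph of bounded degree. -/

section Balls

variable {V : Type*} [Fintype V] [DecidableEq V] (H : SimpleGraph V) [DecidableRel H.Adj]

/-- The vertices at distance at most `k` from `u`. -/
def ball : ℕ → V → Finset V
  | 0, u => {u}
  | k + 1, u => insert u ((H.neighborFinset u).biUnion fun v => ball k v)

theorem mem_ball_iff (k : ℕ) (u v : V) : v ∈ ball H k u ↔ H.edist u v ≤ k := by
  constructor
  · induction k generalizing u with
    | zero => simp only [ball, mem_singleton]; rintro rfl; simp
    | succ k ih =>
      simp only [ball, mem_insert, mem_biUnion, SimpleGraph.mem_neighborFinset]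
      rintro (rfl | ⟨w, huw, hw⟩)
      · simp
      · have h1 : H.edist u w = 1 := SimpleGraph.edist_eq_one_iff_adj.2 huw
        refine (SimpleGraph.edist_triangle (v := w)).trans ?_
        rw [h1, add_comm]
        push_cast
        exact add_le_add (ih w hw) le_rfl
  · intro h
    have hne : H.edist u v ≠ ⊤ := ne_top_of_le_ne_top (ENat.natCast_ne_top k) h
    obtain ⟨p, hp⟩ := SimpleGraph.exists_walk_of_edist_ne_top hne
    rw [← hp] at h
    replace h : p.length ≤ k := by exact_mod_cast h
    clear hp hne
    induction p generalizing k with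
    | nil => cases k <;> simp [ball]
    | cons hadj p ih =>
      rw [SimpleGraph.Walk.length_cons] at h
      obtain ⟨k, rfl⟩ : ∃ j, k = j + 1 := ⟨k - 1, by omega⟩
      simp only [ball, mem_insert, mem_biUnion, SimpleGraph.mem_neighborFinset]
      exact Or.inr ⟨_, hadj, ih _ (by omega)⟩

theorem card_ball_le {d : ℕ} (hd : ∀ v, H.degree v ≤ d) (k : ℕ) (u : V) :
    (ball H k u).card ≤ (d + 1) ^ k := by
  induction k generalizing u with
  | zero => simp [ball]
  | succ k ih =>
    have h1 : ((H.neighborFinset u).biUnion fun v => ball H k v).card ≤ d * (d + 1) ^ k :=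
      (Finset.card_biUnion_le_card_mul _ _ _ fun v _ => ih v).trans
        (Nat.mul_le_mul_right _ (by simpa using hd u))
    have h2 : 1 ≤ (d + 1) ^ k := Nat.one_le_pow _ _ (by omega)
    have := Finset.card_insert_le u ((H.neighborFinset u).biUnion fun v => ball H k v)
    rw [ball, pow_succ]
    nlinarith

end Balls

end GraphContainer

/-! ### Edge boundary and expansion in nearly regular bipartite graphs. -/

namespace GraphContainer

open Finset

variable {V : Type*} [Fintype V] [DecidableEq V]

/-- A bipartite graph all of whose degrees are between `δ d` and `d`, do not increase along edges
from `X` to `Y`, and any two of whose vertices have at most `Δ` common neighbours. -/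
structure NearRegular (H : SimpleGraph V) [DecidableRel H.Adj] (X Y : Finset V) (δ : ℝ)
    (Δ d : ℕ) : Prop where
  bip : H.IsBipartiteWith (X : Set V) (Y : Set V)
  cover : X ∪ Y = univ
  lower : ∀ v, δ * (d : ℝ) ≤ H.degree v
  upper : ∀ v, H.degree v ≤ d
  mono : ∀ v ∈ X, ∀ w ∈ Y, H.Adj v w → H.degree w ≤ H.degree v
  codeg : ∀ v w : V, v ≠ w → (H.neighborFinset v ∩ H.neighborFinset w).card ≤ Δ

variable {H : SimpleGraph V} [DecidableRel H.Adj] {X Y : Finset V} {δ : ℝ} {Δ d : ℕ}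

theorem mem_nbhd {A : Finset V} {w : V} : w ∈ nbhd H A ↔ ∃ v ∈ A, H.Adj v w := by
  simp [nbhd]

theorem mem_closure {A : Finset V} {v : V} :
    v ∈ closure H A ↔ H.neighborFinset v ⊆ nbhd H A := by
  simp [closure]

theorem subset_closure (A : Finset V) : A ⊆ closure H A := by
  intro v hv
  rw [mem_closure]
  intro w hw
  rw [SimpleGraph.mem_neighborFinset] at hw
  exact mem_nbhd.2 ⟨v, hv, hw⟩

theorem adj_closure {A : Finset V} {v w : V} (hv : v ∈ closure H A) (h : H.Adj v w) :
    w ∈ nbhd H A :=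
  mem_closure.1 hv (by simpa using h)

namespace NearRegular

variable (h : NearRegular H X Y δ Δ d)
include h

theorem adj_left {v w : V} (hv : v ∈ X) (hvw : H.Adj v w) : w ∈ Y := by
  simpa using h.bip.mem_of_mem_adj (by simpa using hv) hvw

theorem adj_right {v w : V} (hw : w ∈ Y) (hvw : H.Adj w v) : v ∈ X := by
  simpa using h.bip.symm.mem_of_mem_adj (by simpa using hw) hvw

theorem nbhd_subset {A : Finset V} (hA : A ⊆ X) : nbhd H A ⊆ Y := by
  intro w hw
  obtain ⟨v, hv, hvw⟩ := mem_nbhd.1 hw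
  exact h.adj_left (hA hv) hvw

theorem degree_pos (hd : 0 < δ * d) (v : V) : 0 < H.degree v := by
  have := h.lower v
  exact_mod_cast hd.trans_le this

theorem exists_adj (hd : 0 < δ * d) (v : V) : ∃ w, H.Adj v w :=
  (H.degree_pos_iff_exists_adj v).1 (h.degree_pos hd v)

theorem closure_subset (hd : 0 < δ * d) {A : Finset V} (hA : A ⊆ X) : closure H A ⊆ X := by
  intro v hv
  by_contra hvX
  have hvY : v ∈ Y := by
    have : v ∈ X ∪ Y := by rw [h.cover]; exact mem_univ v
    exact (mem_union.1 this).resolve_left hvX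
  obtain ⟨w, hw⟩ := h.exists_adj hd v
  have h1 := h.adj_right hvY hw
  have h2 := h.nbhd_subset hA (adj_closure hv hw)
  exact (Set.disjoint_left.1 h.bip.disjoint) (by simpa using h1) (by simpa using h2)

/-- Weighing every edge between `S ⊆ X` and `F ⊆ Y` by the inverse degree of one of its ends. -/
theorem card_sub_le (hd : 0 < δ * d) {S F : Finset V} (hS : S ⊆ X) (hF : F ⊆ Y) :
    (S.card : ℝ) - ∑ v ∈ S, ((H.neighborFinset v \ F).card : ℝ) / H.degree v ≤
      F.card - ∑ w ∈ F, ((H.neighborFinset w \ S).card : ℝ) / H.degree w := by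
  have key : ∀ P Q : Finset V,
      (P.card : ℝ) - ∑ v ∈ P, ((H.neighborFinset v \ Q).card : ℝ) / H.degree v =
        ∑ v ∈ P, ∑ w ∈ Q, if H.Adj v w then (1 : ℝ) / H.degree v else 0 := by
    intro P Q
    rw [Finset.card_eq_sum_ones, Nat.cast_sum, ← Finset.sum_sub_distrib]
    refine Finset.sum_congr rfl fun v _ => ?_
    have h0 : (0 : ℝ) < H.degree v := by exact_mod_cast h.degree_pos hd v
    rw [← Finset.sum_filter, Finset.sum_const, nsmul_eq_mul]
    have h1 : Q.filter (fun w => H.Adj v w) = H.neighborFinset v ∩ Q := by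
      ext w; simp [and_comm]
    have h2 := Finset.card_sdiff_add_card_inter (H.neighborFinset v) Q
    rw [SimpleGraph.card_neighborFinset_eq_degree] at h2
    have h3 : ((H.neighborFinset v \ Q).card : ℝ) + (H.neighborFinset v ∩ Q).card = H.degree v := by
      exact_mod_cast h2
    rw [h1]
    field_simp
    push_cast
    linarith
  -- Both sides are now sums over the edges between `S` and `F`; `mono` compares the weights edge by
  -- edge.
  rw [key S F, key F S, Finset.sum_comm]
  refine Finset.sum_le_sum fun w hw => Finset.sum_le_sum fun v hv => ?_
  by_cases hvw : H.Adj v w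
  · rw [if_pos hvw, if_pos hvw.symm]
    have h0 : (0 : ℝ) < H.degree w := by exact_mod_cast h.degree_pos hd w
    have h1 : (H.degree w : ℝ) ≤ H.degree v := by
      exact_mod_cast h.mono v (hS hv) w (hF hw) hvw
    exact one_div_le_one_div_of_le h0 h1
  · rw [if_neg hvw, if_neg fun h' => hvw h'.symm]

variable {A : Finset V} (hA : A ⊆ X) {t : ℝ}
  (ht : t = ((nbhd H A).card : ℝ) - ((closure H A).card : ℝ))
include hA ht

/-- There are at most `t d` edges from `N(A)` to the complement of `[A]`. -/
theorem boundary_le (hd : 0 < δ * d) :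
    ∑ w ∈ nbhd H A, ((H.neighborFinset w \ closure H A).card : ℝ) ≤ t * d := by
  have h1 := h.card_sub_le hd (h.closure_subset hd hA) (h.nbhd_subset hA)
  have h2 : ∑ v ∈ closure H A, ((H.neighborFinset v \ nbhd H A).card : ℝ) / H.degree v = 0 := by
    refine Finset.sum_eq_zero fun v hv => ?_
    rw [Finset.sdiff_eq_empty_iff_subset.2 (mem_closure.1 hv)]
    simp
  rw [h2] at h1
  have hd0 : (0 : ℝ) < d := by
    rcases (Nat.cast_nonneg d : (0 : ℝ) ≤ d).eq_or_lt with h0 | h0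
    · rw [← h0] at hd; simp at hd
    · exact h0
  have h3 : ∑ w ∈ nbhd H A, ((H.neighborFinset w \ closure H A).card : ℝ) / d ≤
      ∑ w ∈ nbhd H A, ((H.neighborFinset w \ closure H A).card : ℝ) / H.degree w := by
    refine Finset.sum_le_sum fun w _ => ?_
    have h0 : (0 : ℝ) < H.degree w := by exact_mod_cast h.degree_pos hd w
    have h4 : (H.degree w : ℝ) ≤ d := by exact_mod_cast h.upper w
    gcongr
  rw [← Finset.sum_div, div_le_iff₀ hd0] at h3
  refine h3.trans ?_
  gcongr
  linarith

/-- Few vertices of `N(A)` have less than half of their least possible degree into `[A]`. -/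
theorem card_bad_le (hδ : 0 < δ) (hd : 0 < d) {B : Finset V} (hB : B ⊆ nbhd H A)
    (hbad : ∀ w ∈ B, ((H.neighborFinset w ∩ closure H A).card : ℝ) < δ * d / 2) :
    (B.card : ℝ) ≤ 2 * t / δ := by
  have hd' : (0 : ℝ) < d := by exact_mod_cast hd
  have h1 := h.boundary_le hA ht (by positivity)
  have h2 : ∑ w ∈ B, ((H.neighborFinset w \ closure H A).card : ℝ) ≤
      ∑ w ∈ nbhd H A, ((H.neighborFinset w \ closure H A).card : ℝ) :=
    Finset.sum_le_sum_of_subset_of_nonneg hB fun _ _ _ => by positivity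
  -- A bad vertex sends at least `δ d / 2` edges out of `[A]`, while only `t d` such edges exist.
  have h3 : ∑ w ∈ B, (δ * d / 2) ≤ ∑ w ∈ B, ((H.neighborFinset w \ closure H A).card : ℝ) := by
    refine Finset.sum_le_sum fun w hw => ?_
    have h4 := Finset.card_sdiff_add_card_inter (H.neighborFinset w) (closure H A)
    rw [SimpleGraph.card_neighborFinset_eq_degree] at h4
    have h5 : ((H.neighborFinset w \ closure H A).card : ℝ) +
      (H.neighborFinset w ∩ closure H A).card = H.degree w := by exact_mod_cast h4
    linarith [hbad w hw, h.lower w]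
  rw [Finset.sum_const, nsmul_eq_mul] at h3
  rw [le_div_iff₀ hδ]
  have h6 : (B.card : ℝ) * δ * d ≤ 2 * t * d := by linarith
  exact le_of_mul_le_mul_right h6 hd'

/-- Few vertices outside `[A]` have at least half of their least possible degree into `N(A)`. -/
theorem card_outside_le (hδ : 0 < δ) (hd : 0 < d) {S E : Finset V} {ψ : ℝ} (hψ : ψ ≤ δ * d / 2)
    (hE : E ⊆ nbhd H A) (hS : ∀ u ∈ S, ((H.neighborFinset u \ E).card : ℝ) < ψ)
    (hSC : Disjoint S (closure H A)) : (S.card : ℝ) ≤ 2 * t / δ := by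
  have hd' : (0 : ℝ) < d := by exact_mod_cast hd
  have h1 := h.boundary_le hA ht (by positivity)
  -- At least `δ d / 2` neighbours of `u` lie in `E ⊆ N(A)`, and since `u ∉ [A]` these edges belong
  -- to the boundary.
  have h2 : ∑ u ∈ S, (δ * d / 2) ≤ ∑ u ∈ S, ((H.neighborFinset u ∩ nbhd H A).card : ℝ) := by
    refine Finset.sum_le_sum fun u hu => ?_
    have h4 := Finset.card_sdiff_add_card_inter (H.neighborFinset u) E
    rw [SimpleGraph.card_neighborFinset_eq_degree] at h4
    have h5 : ((H.neighborFinset u \ E).card : ℝ) +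
      (H.neighborFinset u ∩ E).card = H.degree u := by exact_mod_cast h4
    have h6 : ((H.neighborFinset u ∩ E).card : ℝ) ≤ (H.neighborFinset u ∩ nbhd H A).card := by
      exact_mod_cast Finset.card_le_card (Finset.inter_subset_inter_left hE)
    linarith [hS u hu, h.lower u]
  have h3 : ∑ u ∈ S, (H.neighborFinset u ∩ nbhd H A).card ≤
      ∑ w ∈ nbhd H A, (H.neighborFinset w \ closure H A).card := by
    have h4 := Finset.sum_card_bipartiteAbove_eq_sum_card_bipartiteBelow
      (s := S) (t := nbhd H A) H.Adj
    have h5 : ∀ u, (H.neighborFinset u ∩ nbhd H A) =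
        Finset.bipartiteAbove H.Adj (nbhd H A) u := by
      intro u; ext w; simp [and_comm]
    simp only [h5]
    rw [h4]
    refine Finset.sum_le_sum fun w _ => Finset.card_le_card fun u hu => ?_
    rw [Finset.mem_bipartiteBelow] at hu
    rw [mem_sdiff, SimpleGraph.mem_neighborFinset]
    exact ⟨hu.2.symm, Finset.disjoint_left.1 hSC hu.1⟩
  have h3' : ∑ u ∈ S, ((H.neighborFinset u ∩ nbhd H A).card : ℝ) ≤
      ∑ w ∈ nbhd H A, ((H.neighborFinset w \ closure H A).card : ℝ) := by exact_mod_cast h3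
  rw [Finset.sum_const, nsmul_eq_mul] at h2
  rw [le_div_iff₀ hδ]
  have h6 : (S.card : ℝ) * δ * d ≤ 2 * t * d := by linarith
  exact le_of_mul_le_mul_right h6 hd'

omit hA ht in
/-- Bounded codegrees make the second neighbourhood large. -/
theorem card_nbhd_ge {B : Finset V} {y : V} (hB : B ⊆ H.neighborFinset y) :
    (B.card : ℝ) * (δ * d - 1) ≤ (max Δ 1 : ℕ) * ((nbhd H B).card : ℝ) := by
  -- The vertex `y` is removed because it sees all of `B`; any other vertex shares at most `Δ`
  -- neighbours with `y`. Using `max Δ 1` keeps later denominators positive.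
  have h1 := Finset.sum_card_bipartiteAbove_eq_sum_card_bipartiteBelow
      (s := B) (t := nbhd H B \ {y}) H.Adj
  have h2 : ∀ v ∈ B, δ * d - 1 ≤ ((Finset.bipartiteAbove H.Adj (nbhd H B \ {y}) v).card : ℝ) := by
    intro v hv
    have h3 : H.neighborFinset v \ {y} ⊆ Finset.bipartiteAbove H.Adj (nbhd H B \ {y}) v := by
      intro w hw
      simp only [mem_sdiff, SimpleGraph.mem_neighborFinset, mem_singleton] at hw
      rw [Finset.mem_bipartiteAbove, mem_sdiff, mem_singleton]
      exact ⟨⟨mem_nbhd.2 ⟨v, hv, hw.1⟩, hw.2⟩, hw.1⟩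
    have h4 := Finset.card_le_card h3
    have h5 := Finset.le_card_sdiff {y} (H.neighborFinset v)
    rw [SimpleGraph.card_neighborFinset_eq_degree, card_singleton] at h5
    have h6 : H.degree v ≤ (Finset.bipartiteAbove H.Adj (nbhd H B \ {y}) v).card + 1 := by omega
    have h7 : (H.degree v : ℝ) ≤ (Finset.bipartiteAbove H.Adj (nbhd H B \ {y}) v).card + 1 := by
      exact_mod_cast h6
    linarith [h.lower v]
  have h3 : ∀ w ∈ nbhd H B \ {y}, (Finset.bipartiteBelow H.Adj B w).card ≤ max Δ 1 := by
    intro w hw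
    rw [mem_sdiff, mem_singleton] at hw
    refine (Finset.card_le_card ?_).trans ((h.codeg y w (Ne.symm hw.2)).trans (le_max_left _ _))
    intro v hv
    rw [Finset.mem_bipartiteBelow] at hv
    exact mem_inter.2 ⟨hB hv.1, by simpa using hv.2.symm⟩
  calc (B.card : ℝ) * (δ * d - 1) = ∑ v ∈ B, (δ * d - 1) := by
        rw [Finset.sum_const, nsmul_eq_mul]
    _ ≤ ∑ v ∈ B, ((Finset.bipartiteAbove H.Adj (nbhd H B \ {y}) v).card : ℝ) :=
        Finset.sum_le_sum h2
    _ = ∑ w ∈ nbhd H B \ {y}, ((Finset.bipartiteBelow H.Adj B w).card : ℝ) := by exact_mod_cast h1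
    _ ≤ ∑ w ∈ nbhd H B \ {y}, ((max Δ 1 : ℕ) : ℝ) :=
        Finset.sum_le_sum fun w hw => by exact_mod_cast h3 w hw
    _ = (max Δ 1 : ℕ) * ((nbhd H B \ {y}).card : ℝ) := by
        rw [Finset.sum_const, nsmul_eq_mul, mul_comm]
    _ ≤ (max Δ 1 : ℕ) * ((nbhd H B).card : ℝ) := by
        gcongr; exact Finset.sdiff_subset

end NearRegular

end GraphContainer

/-! ### Linked sets and the number of codes. -/

namespace GraphContainer

open Finset

variable {V : Type*} [Fintype V] [DecidableEq V]

-- If no step of length 8 left `P`, consider the vertices of `A` within 3 of `P`. They are neither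
-- none nor all of `A`, so linkedness gives two vertices of `A` at distance at most 2 across the
-- cut, and `3 + 2 + 3 = 8`.
open Classical in
theorem unsplit_of_isLinked {H : SimpleGraph V} [DecidableRel H.Adj] {A W : Finset V}
    (hA : IsLinked H 2 A) {r : V} (hr : r ∈ W) (hW : ∀ w ∈ W, ∃ v ∈ A, H.edist w v ≤ 3)
    (hAW : ∀ v ∈ A, ∃ w ∈ W, H.edist v w ≤ 3) : Unsplit (ball H 8) r W := by
  refine ⟨hr, fun P hP hrP => ?_⟩
  by_contra! hno
  have hno' : ∀ u ∈ P, ∀ v ∈ W \ P, ¬ H.edist u v ≤ 8 := by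
    intro u hu v hv huv
    exact hno u hu v hv ((mem_ball_iff H 8 u v).2 (by exact_mod_cast huv))
  obtain ⟨w₀, hw₀W, hw₀P⟩ := Finset.exists_of_ssubset hP
  obtain ⟨v₁, hv₁, h₁⟩ := hW r hr
  obtain ⟨v₂, hv₂, h₂⟩ := hW w₀ hw₀W
  let S : Set (A : Set V) := {v | ∃ w ∈ P, H.edist v w ≤ 3}
  have hS₁ : (⟨v₁, hv₁⟩ : (A : Set V)) ∈ S := ⟨r, hrP, by rwa [SimpleGraph.edist_comm]⟩
  have hS₂ : (⟨v₂, hv₂⟩ : (A : Set V)) ∉ S := by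
    rintro ⟨w, hw, hvw⟩
    refine hno' w hw w₀ (mem_sdiff.2 ⟨hw₀W, hw₀P⟩) ?_
    refine (SimpleGraph.edist_triangle (v := v₂)).trans ?_
    rw [SimpleGraph.edist_comm] at hvw h₂
    exact (add_le_add hvw h₂).trans (by norm_num)
  obtain ⟨p⟩ := hA.preconnected ⟨v₁, hv₁⟩ ⟨v₂, hv₂⟩
  obtain ⟨e, -, ⟨w, hw, hew⟩, he₂⟩ := p.exists_boundary_dart S hS₁ hS₂
  obtain ⟨w', hw', hew'⟩ := hAW e.snd e.snd.2
  have hw'P : w' ∉ P := fun h' => he₂ ⟨w', h', hew'⟩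
  refine hno' w hw w' (mem_sdiff.2 ⟨hw', hw'P⟩) ?_
  have h2 : H.edist (e.fst : V) e.snd ≤ 2 := by
    have := e.adj
    rw [SimpleGraph.comap_adj] at this
    exact_mod_cast this.2
  rw [SimpleGraph.edist_comm] at hew
  calc H.edist w w' ≤ H.edist w e.fst + H.edist (e.fst : V) w' := SimpleGraph.edist_triangle
    _ ≤ 3 + (2 + 3) := add_le_add hew (SimpleGraph.edist_triangle.trans (add_le_add h2 hew'))
    _ ≤ 8 := by norm_num

open Classical in
/-- Sets that are contained in small sets decoded from six subsets of an unsplit set are few. -/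
theorem card_le_of_codes (H : SimpleGraph V) [DecidableRel H.Adj] {d : ℕ}
    (hd : ∀ v, H.degree v ≤ d) (Y : Finset V) (fam : Finset (Finset V)) (n : ℕ)
    (dec : (Fin 6 → Finset V) → Finset V) (b : ℝ) (hb : 0 ≤ b)
    (hfam : ∀ A ∈ fam, ∃ r ∈ Y, ∃ c : Fin 6 → Finset V,
      Unsplit (ball H 8) r (univ.biUnion c) ∧ (univ.biUnion c).card ≤ n ∧
        A ⊆ dec c ∧ ((dec c).card : ℝ) ≤ b) :
    (fam.card : ℝ) ≤ Y.card * ((((d : ℝ) + 1) ^ 8) ^ (2 * n) * (2 ^ n) ^ 6) * (2 : ℝ) ^ b := by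
  set Ws : V → Finset (Finset V) := fun r =>
    univ.filter fun W => Unsplit (ball H 8) r W ∧ W.card ≤ n with hWs
  set codes : Finset (Fin 6 → Finset V) := Y.biUnion fun r => (Ws r).biUnion fun W =>
    Fintype.piFinset fun _ => W.powerset with hcodes
  have hWcard : ∀ r, (Ws r).card ≤ ((d + 1) ^ 8) ^ (2 * n) := fun r =>
    card_unsplit_le (B := ball H 8) (fun v => (mem_ball_iff H 8 v v).2 (by simp))
      (fun u v huv => by
        rw [mem_ball_iff] at huv ⊢
        rwa [SimpleGraph.edist_comm]) (card_ball_le H hd 8) r n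
  have hcodes_card : codes.card ≤ Y.card * (((d + 1) ^ 8) ^ (2 * n) * (2 ^ n) ^ 6) := by
    refine Finset.card_biUnion_le_card_mul _ _ _ fun r _ => ?_
    refine (Finset.card_biUnion_le_card_mul _ _ ((2 ^ n) ^ 6) fun W hW => ?_).trans
      (Nat.mul_le_mul_right _ (hWcard r))
    rw [Fintype.card_piFinset]
    simp only [card_powerset, prod_const, card_univ, Fintype.card_fin]
    exact Nat.pow_le_pow_left (Nat.pow_le_pow_right (by norm_num) (mem_filter.1 hW).2.2) 6
  have hsub : fam ⊆ (codes.filter fun c => ((dec c).card : ℝ) ≤ b).biUnion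
      fun c => (dec c).powerset := by
    intro A hA
    obtain ⟨r, hr, c, h1, h2, h3, h4⟩ := hfam A hA
    refine mem_biUnion.2 ⟨c, mem_filter.2 ⟨?_, h4⟩, mem_powerset.2 h3⟩
    refine mem_biUnion.2 ⟨r, hr, mem_biUnion.2 ⟨univ.biUnion c, ?_, ?_⟩⟩
    · exact mem_filter.2 ⟨mem_univ _, h1, h2⟩
    · rw [Fintype.mem_piFinset]
      exact fun i => mem_powerset.2 (Finset.subset_biUnion_of_mem c (mem_univ i))
  have hcard : fam.card ≤ codes.card * 2 ^ ⌊b⌋₊ := by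
    refine (card_le_card hsub).trans ((Finset.card_biUnion_le_card_mul _ _ (2 ^ ⌊b⌋₊)
      fun c hc => ?_).trans (Nat.mul_le_mul_right _ (card_filter_le _ _)))
    rw [card_powerset]
    exact Nat.pow_le_pow_right (by norm_num) (Nat.le_floor (mem_filter.1 hc).2)
  have h5 : ((2 : ℝ) ^ ⌊b⌋₊) ≤ (2 : ℝ) ^ b := by
    rw [← Real.rpow_natCast]
    exact Real.rpow_le_rpow_of_exponent_le (by norm_num) (Nat.floor_le hb)
  calc (fam.card : ℝ) ≤ (codes.card : ℝ) * 2 ^ ⌊b⌋₊ := by exact_mod_cast hcard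
    _ ≤ (Y.card * ((((d : ℝ) + 1) ^ 8) ^ (2 * n) * (2 ^ n) ^ 6)) * (2 : ℝ) ^ b := by
      gcongr
      exact_mod_cast hcodes_card

/-! ### Approximating `N(A)` from inside and `[A]` from outside. -/

/-- The part of `N(A)` decoded from the neighbours of a sample `T`, all but `Z` of which lie
in `[A]`, from further vertices `T₁` of `N(A)`, and from vertices `U` of `[A]`. -/
def inner (H : SimpleGraph V) [DecidableRel H.Adj] (T Z T₁ U : Finset V) : Finset V :=
  nbhd H (nbhd H T \ Z) ∪ T₁ ∪ nbhd H U

open Classical in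
/-- The vertices of `X` with fewer than `ψ` neighbours outside `E` and none in `U`. -/
noncomputable def outer (H : SimpleGraph V) [DecidableRel H.Adj] (X : Finset V) (ψ : ℝ)
    (E U : Finset V) : Finset V :=
  (X.filter fun u => ((H.neighborFinset u \ E).card : ℝ) < ψ) \ nbhd H U

open Classical in
/-- `E` together with the vertices of `Y` that have at least `ψ` neighbours in `S`. -/
noncomputable def fill (H : SimpleGraph V) [DecidableRel H.Adj] (Y : Finset V) (ψ : ℝ)
    (E S : Finset V) : Finset V :=
  E ∪ Y.filter fun w => ψ ≤ ((H.neighborFinset w ∩ S).card : ℝ)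

variable {H : SimpleGraph V} [DecidableRel H.Adj] {X Y : Finset V} {δ : ℝ} {Δ d : ℕ}

theorem three_mul_div_identity (L t : ℝ) {c d g : ℝ} (hc : c ≠ 0) (hg : g ≠ 0) (hd : d ≠ 0) :
    3 * L / (c * d ^ 2 / g) * (t * d / g) = 3 * L * t / (c * d) := by
  field_simp

namespace NearRegular

variable (h : NearRegular H X Y δ Δ d) {A : Finset V} (hA : A ⊆ X) {t : ℝ}
  (ht : t = ((nbhd H A).card : ℝ) - ((closure H A).card : ℝ))
include h hA ht

-- A vertex `w` with many neighbours in `[A]` reaches at least `c₀ d²` vertices of `N(A)` through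
-- them, a proportion `q`. About `2L/q` samples miss it with probability at most `d⁻²`, and the
-- average sample sends at most `t d / g` edges out of `[A]`. The set `T₁` holds the missed vertices
-- and the root `y₀`, hence the final `1`.
open Classical in
theorem exists_sample (ht0 : 0 ≤ t) (hδ : 0 < δ) (hd : 2 ≤ δ * d) {y₀ : V} (hy₀ : y₀ ∈ nbhd H A)
    {L c₀ : ℝ} (hL : 1 ≤ L) (hLd : Real.log d ≤ L) (hc₀ : c₀ = δ ^ 2 / (4 * (max Δ 1 : ℕ))) :
    ∃ T ⊆ nbhd H A, ∃ T₁ ⊆ nbhd H A, y₀ ∈ T₁ ∧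
      (∀ w ∈ nbhd H A, δ * d / 2 ≤ ((H.neighborFinset w ∩ closure H A).card : ℝ) →
        w ∈ nbhd H (nbhd H T \ (nbhd H T \ closure H A)) ∪ T₁) ∧
      (T.card : ℝ) + ((nbhd H T \ closure H A).card : ℝ) + (T₁.card : ℝ) ≤
        3 * L * (nbhd H A).card / (c₀ * d ^ 2) + 3 * L * t / (c₀ * d) +
          (nbhd H A).card / (d : ℝ) ^ 2 + 1 := by
  have hd0 : (0 : ℝ) < d := by
    rcases (Nat.cast_nonneg d : (0 : ℝ) ≤ d).eq_or_lt with h0 | h0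
    · rw [← h0] at hd; norm_num at hd
    · exact h0
  have hM : (0 : ℝ) < (max Δ 1 : ℕ) := by
    exact_mod_cast lt_of_lt_of_le Nat.one_pos (le_max_right Δ 1)
  have hc0 : 0 < c₀ := by rw [hc₀]; positivity
  have hg : (0 : ℝ) < (nbhd H A).card := by exact_mod_cast card_pos.2 ⟨y₀, hy₀⟩
  obtain ⟨g, hgdef⟩ : ∃ g : ℝ, ((nbhd H A).card : ℝ) = g := ⟨_, rfl⟩
  rw [hgdef] at hg ⊢
  set C := closure H A with hC
  set Good := (nbhd H A).filter fun w =>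
    δ * d / 2 ≤ ((H.neighborFinset w ∩ C).card : ℝ) with hGood
  have hball : ∀ u ∈ Good, c₀ * d ^ 2 ≤ ((nbhd H (H.neighborFinset u ∩ C)).card : ℝ) := by
    intro u hu
    have h1 := (mem_filter.1 hu).2
    have h2 := h.card_nbhd_ge (B := H.neighborFinset u ∩ C) inter_subset_left
    have h3 : (δ * d / 2) * (δ * d / 2) ≤
        ((H.neighborFinset u ∩ C).card : ℝ) * (δ * d - 1) :=
      mul_le_mul h1 (by linarith) (by linarith) (by positivity)
    rw [hc₀, div_mul_eq_mul_div, div_le_iff₀ (by positivity)]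
    nlinarith
  have hball_sub : ∀ u, nbhd H (H.neighborFinset u ∩ C) ⊆ nbhd H A := by
    intro u w hw
    obtain ⟨v, hv, hvw⟩ := mem_nbhd.1 hw
    exact adj_closure (mem_inter.1 hv).2 hvw
  -- A good vertex is needed only to see that `q ≤ 1`.
  rcases Good.eq_empty_or_nonempty with hempty | ⟨u₀, hu₀⟩
  · refine ⟨∅, by simp, {y₀}, by simpa using hy₀, by simp, ?_, ?_⟩
    · intro w hw hw'
      have : w ∈ Good := mem_filter.2 ⟨hw, hw'⟩
      rw [hempty] at this
      simp at this
    · have : 0 ≤ 3 * L * g / (c₀ * d ^ 2) + 3 * L * t / (c₀ * d) + g / (d : ℝ) ^ 2 := by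
        positivity
      simpa [nbhd] using this
  set q : ℝ := c₀ * d ^ 2 / g with hq
  have hq0 : 0 < q := by positivity
  have hq1 : q ≤ 1 := by
    rw [hq, div_le_one hg]
    exact (hball u₀ hu₀).trans (hgdef ▸ Nat.cast_le.2 (card_le_card (hball_sub u₀)))
  set m := ⌈2 * L / q⌉₊ with hm
  obtain ⟨T, hTG, hTm, hT⟩ := exists_cheap_cover (nbhd H A) ⟨y₀, hy₀⟩
    (fun w => ((H.neighborFinset w \ C).card : ℝ)) (fun w => by positivity)
    (fun u w => w ∈ nbhd H (H.neighborFinset u ∩ C)) q hq1 m Good (by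
      intro u hu
      rw [hgdef, hq, div_mul_cancel₀ _ hg.ne']
      refine (hball u hu).trans (Nat.cast_le.2 (card_le_card fun w hw => ?_))
      rw [mem_filter]
      exact ⟨hball_sub u hw, hw⟩)
  rw [hgdef] at hT
  set miss := Good.filter fun u => ∀ w ∈ T, ¬ w ∈ nbhd H (H.neighborFinset u ∩ C) with hmiss
  replace hT : ∑ w ∈ T, ((H.neighborFinset w \ C).card : ℝ) + (miss.card : ℝ) ≤
      m * ((∑ w ∈ nbhd H A, ((H.neighborFinset w \ C).card : ℝ)) / g) +
        Good.card * (1 - q) ^ m := by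
    convert hT
  refine ⟨T, hTG, insert y₀ miss, insert_subset hy₀ fun u hu =>
    (mem_filter.1 (mem_filter.1 hu).1).1, mem_insert_self _ _, ?_, ?_⟩
  · intro u hu hu'
    by_cases hum : u ∈ miss
    · exact mem_union_right _ (mem_insert_of_mem hum)
    · have huG : u ∈ Good := mem_filter.2 ⟨hu, hu'⟩
      have : ∃ w ∈ T, w ∈ nbhd H (H.neighborFinset u ∩ C) := by
        by_contra! hcon
        exact hum (mem_filter.2 ⟨huG, hcon⟩)
      obtain ⟨w, hwT, hw⟩ := this
      obtain ⟨v, hv, hvw⟩ := mem_nbhd.1 hw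
      rw [mem_inter, SimpleGraph.mem_neighborFinset] at hv
      refine mem_union_left _ (mem_nbhd.2 ⟨v, ?_, hv.1.symm⟩)
      rw [mem_sdiff, mem_sdiff]
      exact ⟨mem_nbhd.2 ⟨w, hwT, hvw.symm⟩, fun hh => hh.2 hv.2⟩
  · have hZ : ((nbhd H T \ C).card : ℝ) ≤ ∑ w ∈ T, ((H.neighborFinset w \ C).card : ℝ) := by
      have : nbhd H T \ C ⊆ T.biUnion fun w => H.neighborFinset w \ C := by
        intro v hv
        obtain ⟨hv1, hv2⟩ := mem_sdiff.1 hv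
        obtain ⟨w, hw, hwv⟩ := mem_nbhd.1 hv1
        exact mem_biUnion.2 ⟨w, hw, mem_sdiff.2 ⟨by simpa using hwv, hv2⟩⟩
      exact_mod_cast (card_le_card this).trans card_biUnion_le
    have hT1 : ((insert y₀ miss).card : ℝ) ≤ miss.card + 1 := by
      exact_mod_cast card_insert_le _ _
    have hbd := h.boundary_le hA ht (by linarith)
    have hGg : (Good.card : ℝ) ≤ g := hgdef ▸ Nat.cast_le.2 (card_filter_le _ _)
    have hm1 : (m : ℝ) ≤ 3 * L / q := by
      have h1 : (m : ℝ) < 2 * L / q + 1 := Nat.ceil_lt_add_one (by positivity)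
      have h2 : 1 ≤ L / q := by rw [le_div_iff₀ hq0]; linarith
      have h3 : 3 * L / q = 2 * L / q + L / q := by ring
      linarith
    have hm2 : (1 - q) ^ m ≤ 1 / (d : ℝ) ^ 2 := by
      have h1 : (1 - q) ^ m ≤ Real.exp (-q) ^ m :=
        pow_le_pow_left₀ (by linarith) (Real.one_sub_le_exp_neg q) m
      have h2 : 2 * L ≤ q * m := by
        have := Nat.le_ceil (2 * L / q)
        rw [div_le_iff₀ hq0] at this
        linarith
      have h3 : Real.exp (-q) ^ m ≤ Real.exp (-(2 * Real.log d)) := by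
        rw [← Real.exp_nat_mul]
        apply Real.exp_le_exp.2
        linarith
      have h4 : Real.exp (-(2 * Real.log d)) = 1 / (d : ℝ) ^ 2 := by
        rw [Real.exp_neg, mul_comm, Real.exp_mul, Real.exp_log hd0, one_div]
        norm_num
      linarith
    have h6 : m * ((∑ w ∈ nbhd H A, ((H.neighborFinset w \ C).card : ℝ)) / g) ≤
        3 * L / q * (t * d / g) :=
      mul_le_mul hm1 (div_le_div_of_nonneg_right hbd hg.le)
        (div_nonneg (Finset.sum_nonneg fun _ _ => Nat.cast_nonneg _) hg.le) (by positivity)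
    have h7 : (Good.card : ℝ) * (1 - q) ^ m ≤ g * (1 / (d : ℝ) ^ 2) :=
      mul_le_mul hGg hm2 (pow_nonneg (by linarith) m) hg.le
    have h8 : 3 * L / q * (t * d / g) = 3 * L * t / (c₀ * d) := by
      rw [hq]; exact three_mul_div_identity _ _ hc0.ne' hg.ne' hd0.ne'
    have h9 : 3 * L / q = 3 * L * g / (c₀ * d ^ 2) := by
      rw [hq, div_div_eq_mul_div]
    have h10 : g * (1 / (d : ℝ) ^ 2) = g / (d : ℝ) ^ 2 := by ring
    have hTm' : (T.card : ℝ) ≤ m := by exact_mod_cast hTm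
    linarith

-- Each member of `U₁ ⊆ [A]` reveals `ψ` new vertices of `N(A)`, all among the at most `2t/δ` bad
-- ones. Each member of `U₂`, taken outside `N(A)`, deletes `ψ` new vertices from the candidates for
-- `[A]`; none of these is in `[A]`, so again there are at most `2t/δ`. After that few edges join
-- `S` to the complement of `F`, and `card_sub_le` compares the sizes.
open Classical in
theorem exists_approx (hδ : 0 < δ) (hd : 0 < d) {ψ : ℝ} (hψ0 : 0 < ψ) (hψ : ψ ≤ δ * d / 2)
    {T T₁ : Finset V} (hT₁ : T₁ ⊆ nbhd H A)
    (hgood : ∀ w ∈ nbhd H A, δ * d / 2 ≤ ((H.neighborFinset w ∩ closure H A).card : ℝ) →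
        w ∈ nbhd H (nbhd H T \ (nbhd H T \ closure H A)) ∪ T₁) :
    ∃ U₁ ⊆ closure H A, ∃ U₂ : Finset V, ∃ E S F : Finset V,
      E = inner H T (nbhd H T \ closure H A) T₁ U₁ ∧ S = outer H X ψ E U₂ ∧ F = fill H Y ψ E S ∧
      (U₁.card : ℝ) ≤ 2 * t / δ / ψ ∧ (U₂.card : ℝ) ≤ 2 * t / δ / ψ ∧
      E ⊆ nbhd H A ∧ closure H A ⊆ S ∧ F ⊆ nbhd H A ∧
      (S.card : ℝ) ≤ F.card + 4 * ψ * t / (δ ^ 2 * d) ∧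
      (∀ u ∈ closure H A, ∃ w ∈ E, H.Adj u w) ∧
      ∀ w ∈ U₂, ∃ u, H.Adj w u ∧ ∃ z ∈ E, H.Adj u z := by
  have hd0 : (0 : ℝ) < d := by exact_mod_cast hd
  have hδd : 0 < δ * d := by positivity
  set C := closure H A with hC
  set G := nbhd H A with hG
  have hCX : C ⊆ X := h.closure_subset hδd hA
  have hGY : G ⊆ Y := h.nbhd_subset hA
  set E₀ := nbhd H (nbhd H T \ (nbhd H T \ C)) ∪ T₁ with hE₀
  have hE₀G : E₀ ⊆ G := by
    refine union_subset ?_ hT₁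
    intro w hw
    obtain ⟨v, hv, hvw⟩ := mem_nbhd.1 hw
    rw [mem_sdiff, mem_sdiff] at hv
    have : v ∈ C := by by_contra hh; exact hv.2 ⟨hv.1, hh⟩
    exact adj_closure this hvw
  obtain ⟨U₁, hU₁C, hU₁, hmax₁⟩ := exists_exhausting C (fun v => H.neighborFinset v) E₀ ψ hψ0
  set E := E₀ ∪ nbhd H U₁ with hE
  have hEG : E ⊆ G := by
    refine union_subset hE₀G fun w hw => ?_
    obtain ⟨v, hv, hvw⟩ := mem_nbhd.1 hw
    exact adj_closure (hU₁C hv) hvw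
  have hmax₁' : ∀ u ∈ C, ((H.neighborFinset u \ E).card : ℝ) < ψ := hmax₁
  set S₀ := X.filter fun u => ((H.neighborFinset u \ E).card : ℝ) < ψ with hS₀
  have hCS₀ : C ⊆ S₀ := fun u hu => mem_filter.2 ⟨hCX hu, hmax₁' u hu⟩
  have hEadj : ∀ u, ((H.neighborFinset u \ E).card : ℝ) < ψ → ∃ w ∈ E, H.Adj u w := by
    intro u hu
    by_contra! hcon
    have : H.neighborFinset u \ E = H.neighborFinset u := by
      rw [Finset.sdiff_eq_self_iff_disjoint, Finset.disjoint_left]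
      intro w hw hwE
      exact hcon w hwE (by simpa using hw)
    rw [this, SimpleGraph.card_neighborFinset_eq_degree] at hu
    linarith [h.lower u]
  -- Requiring a neighbour in `S₀` keeps `U₂` within distance 2 of `E`, hence the code near `A`.
  obtain ⟨U₂, hU₂P, hU₂, hmax₂⟩ := exists_exhausting
    ((Y \ G).filter fun w => (H.neighborFinset w ∩ S₀).Nonempty)
    (fun w => H.neighborFinset w ∩ S₀) ∅ ψ hψ0
  have hU₂' : ∀ w ∈ U₂, w ∈ Y ∧ w ∉ G ∧ (H.neighborFinset w ∩ S₀).Nonempty := by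
    intro w hw
    have := mem_filter.1 (hU₂P hw)
    exact ⟨(mem_sdiff.1 this.1).1, (mem_sdiff.1 this.1).2, this.2⟩
  set S := S₀ \ nbhd H U₂ with hS
  have hCS : C ⊆ S := by
    intro u hu
    refine mem_sdiff.2 ⟨hCS₀ hu, fun hu' => ?_⟩
    obtain ⟨w, hw, hwu⟩ := mem_nbhd.1 hu'
    exact (hU₂' w hw).2.1 (adj_closure hu hwu.symm)
  have hmax₂' : ∀ w ∈ Y, w ∉ G → ((H.neighborFinset w ∩ S).card : ℝ) < ψ := by
    intro w hw hwG
    by_cases hne : (H.neighborFinset w ∩ S₀).Nonempty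
    · refine lt_of_le_of_lt ?_ (hmax₂ w (mem_filter.2 ⟨mem_sdiff.2 ⟨hw, hwG⟩, hne⟩))
      refine Nat.cast_le.2 (card_le_card fun u hu => ?_)
      rw [mem_inter, hS, mem_sdiff] at hu
      rw [mem_sdiff, mem_inter, empty_union]
      refine ⟨⟨hu.1, hu.2.1⟩, fun hh => hu.2.2 ?_⟩
      obtain ⟨z, hz, hzu⟩ := mem_biUnion.1 hh
      exact mem_nbhd.2 ⟨z, hz, by simpa using (mem_inter.1 hzu).1⟩
    · have : H.neighborFinset w ∩ S = ∅ := by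
        rw [Finset.not_nonempty_iff_eq_empty] at hne
        rw [← Finset.subset_empty, ← hne]
        exact inter_subset_inter_left sdiff_subset
      rw [this]
      simpa using hψ0
  set F := E ∪ Y.filter fun w => ψ ≤ ((H.neighborFinset w ∩ S).card : ℝ) with hF
  have hFG : F ⊆ G := by
    refine union_subset hEG fun w hw => ?_
    by_contra hwG
    have := mem_filter.1 hw
    exact absurd (hmax₂' w this.1 hwG) (not_lt.2 this.2)
  have hbad : ∀ B ⊆ G, Disjoint B E₀ → (B.card : ℝ) ≤ 2 * t / δ := by
    intro B hB hBE
    refine h.card_bad_le hA ht hδ hd hB fun w hw => ?_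
    by_contra! hcon
    exact Finset.disjoint_left.1 hBE hw (hgood w (hB hw) hcon)
  have hout : ∀ B ⊆ S₀, Disjoint B C → (B.card : ℝ) ≤ 2 * t / δ := fun B hB hBC =>
    h.card_outside_le hA ht hδ hd hψ hEG (fun u hu => (mem_filter.1 (hB hu)).2) hBC
  refine ⟨U₁, hU₁C, U₂, E, S, F, rfl, rfl, rfl, ?_, ?_, hEG, hCS, hFG, ?_,
    fun u hu => hEadj u (hmax₁' u hu), ?_⟩
  · rw [le_div_iff₀ hψ0, mul_comm]
    refine hU₁.trans (hbad _ ?_ sdiff_disjoint)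
    refine sdiff_subset.trans fun w hw => ?_
    obtain ⟨v, hv, hvw⟩ := mem_biUnion.1 hw
    exact adj_closure (hU₁C hv) (by simpa using hvw)
  · rw [le_div_iff₀ hψ0, mul_comm]
    refine hU₂.trans (hout _ ?_ ?_)
    · refine sdiff_subset.trans fun u hu => ?_
      obtain ⟨w, -, hwu⟩ := mem_biUnion.1 hu
      exact (mem_inter.1 hwu).2
    · rw [Finset.disjoint_left]
      intro u hu huC
      obtain ⟨w, hw, hwu⟩ := mem_biUnion.1 (mem_sdiff.1 hu).1
      have hadj : H.Adj w u := by simpa using (mem_inter.1 hwu).1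
      exact (hU₂' w hw).2.1 (adj_closure huC hadj.symm)
  · have hSX : S ⊆ X := sdiff_subset.trans (filter_subset _ _)
    have h1 := h.card_sub_le hδd hSX (hFG.trans hGY)
    have h2 : 0 ≤ ∑ w ∈ F, ((H.neighborFinset w \ S).card : ℝ) / H.degree w :=
      Finset.sum_nonneg fun _ _ => by positivity
    have h3 : ∑ v ∈ S, ((H.neighborFinset v \ F).card : ℝ) / H.degree v ≤
        (∑ v ∈ S, ((H.neighborFinset v \ F).card : ℝ)) / (δ * d) := by
      rw [Finset.sum_div]
      refine Finset.sum_le_sum fun v _ => ?_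
      have := h.lower v
      gcongr
    -- Edges from `S` that avoid `F` either start in `S \ C` or end in `G \ F`. Each of these sets
    -- has at most `2t/δ` vertices, and each vertex carries at most `ψ` such edges.
    have h4 : ∑ v ∈ S \ C, ((H.neighborFinset v \ F).card : ℝ) ≤ 2 * t / δ * ψ := by
      calc ∑ v ∈ S \ C, ((H.neighborFinset v \ F).card : ℝ) ≤ ∑ v ∈ S \ C, ψ := by
            refine Finset.sum_le_sum fun v hv => ?_
            have hv0 := (mem_filter.1 (mem_sdiff.1 (mem_sdiff.1 hv).1).1).2
            refine le_trans ?_ hv0.le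
            exact_mod_cast card_le_card (sdiff_subset_sdiff subset_rfl subset_union_left)
        _ = ((S \ C).card : ℝ) * ψ := by rw [Finset.sum_const, nsmul_eq_mul]
        _ ≤ 2 * t / δ * ψ := by
            gcongr
            exact hout _ (sdiff_subset.trans sdiff_subset) sdiff_disjoint
    have h5 : ∑ v ∈ C, ((H.neighborFinset v \ F).card : ℝ) ≤ 2 * t / δ * ψ := by
      have h6 := Finset.sum_card_bipartiteAbove_eq_sum_card_bipartiteBelow
        (s := C) (t := G \ F) H.Adj
      calc ∑ v ∈ C, ((H.neighborFinset v \ F).card : ℝ)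
          ≤ ∑ v ∈ C, ((Finset.bipartiteAbove H.Adj (G \ F) v).card : ℝ) := by
            refine Finset.sum_le_sum fun v hv => Nat.cast_le.2 (card_le_card fun w hw => ?_)
            rw [mem_sdiff, SimpleGraph.mem_neighborFinset] at hw
            rw [Finset.mem_bipartiteAbove, mem_sdiff]
            exact ⟨⟨adj_closure hv hw.1, hw.2⟩, hw.1⟩
        _ = ∑ w ∈ G \ F, ((Finset.bipartiteBelow H.Adj C w).card : ℝ) := by exact_mod_cast h6
        _ ≤ ∑ w ∈ G \ F, ψ := by
            refine Finset.sum_le_sum fun w hw => ?_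
            have h7 : ((H.neighborFinset w ∩ S).card : ℝ) ≤ ψ := by
              by_contra! hcon
              obtain ⟨hwG, hwF⟩ := mem_sdiff.1 hw
              exact hwF (mem_union_right _ (mem_filter.2 ⟨hGY hwG, hcon.le⟩))
            refine le_trans (Nat.cast_le.2 (card_le_card fun u hu => ?_)) h7
            rw [Finset.mem_bipartiteBelow] at hu
            exact mem_inter.2 ⟨by simpa using hu.2.symm, hCS hu.1⟩
        _ = ((G \ F).card : ℝ) * ψ := by rw [Finset.sum_const, nsmul_eq_mul]
        _ ≤ 2 * t / δ * ψ := by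
            gcongr
            refine hbad _ sdiff_subset ?_
            exact sdiff_disjoint.mono_right (subset_union_left.trans subset_union_left)
    have h6 := Finset.sum_sdiff (f := fun v => ((H.neighborFinset v \ F).card : ℝ)) hCS
    have h7 : (∑ v ∈ S, ((H.neighborFinset v \ F).card : ℝ)) / (δ * d) ≤
        4 * ψ * t / (δ ^ 2 * d) := by
      rw [div_le_iff₀ hδd]
      have : 4 * ψ * t / (δ ^ 2 * d) * (δ * d) = 2 * t / δ * ψ + 2 * t / δ * ψ := by
        field_simp; ring
      rw [this]
      linarith
    linarith
  · intro w hw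
    obtain ⟨-, -, u, hu⟩ := hU₂' w hw
    rw [mem_inter, SimpleGraph.mem_neighborFinset] at hu
    exact ⟨u, hu.1, hEadj u (mem_filter.1 hu.2).2⟩

end NearRegular

end GraphContainer

/-! ### The two kinds of codes. -/

namespace GraphContainer

open Finset

variable {V : Type*} [Fintype V] [DecidableEq V]

/-- The decoded superset of `[A]` that is used when it is small. -/
noncomputable def decodeOuter (H : SimpleGraph V) [DecidableRel H.Adj] (X : Finset V) (ψ : ℝ)
    (c : Fin 6 → Finset V) : Finset V :=
  outer H X ψ (inner H (c 0) (c 1) (c 2) (c 3)) (c 4)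

/-- The decoded value of `[A]` that is used when `N(A)` is almost known. -/
noncomputable def decodeClosure (H : SimpleGraph V) [DecidableRel H.Adj] (X Y : Finset V) (ψ : ℝ)
    (c : Fin 6 → Finset V) : Finset V :=
  univ.filter fun v => H.neighborFinset v ⊆
    fill H Y ψ (inner H (c 0) (c 1) (c 2) (c 3)) (decodeOuter H X ψ c) ∪ c 5

/-- `A` is contained in the set of size at most `b` decoded from six subsets of an unsplit set
of size at most `n`. -/
def HasCode (H : SimpleGraph V) [DecidableRel H.Adj] (Y : Finset V)
    (dec : (Fin 6 → Finset V) → Finset V) (n b : ℝ) (A : Finset V) : Prop :=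
  ∃ r ∈ Y, ∃ c : Fin 6 → Finset V, Unsplit (ball H 8) r (univ.biUnion c) ∧
    ((univ.biUnion c).card : ℝ) ≤ n ∧ A ⊆ dec c ∧ ((dec c).card : ℝ) ≤ b

variable {H : SimpleGraph V} [DecidableRel H.Adj] {X Y : Finset V} {δ : ℝ} {Δ d : ℕ}

theorem edist_le_one {V : Type*} {H : SimpleGraph V} {u v : V} (h : H.Adj u v) : H.edist u v ≤ 1 :=
  (SimpleGraph.edist_eq_one_iff_adj.2 h).le

theorem edist_le_two {V : Type*} {H : SimpleGraph V} {u v w : V} (h : H.Adj u v) (h' : H.Adj v w) : H.edist u w ≤ 2 :=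
  SimpleGraph.edist_triangle.trans
    ((add_le_add (edist_le_one h) (edist_le_one h')).trans (by norm_num))

theorem edist_le_three {V : Type*} {H : SimpleGraph V} {u v w z : V} (h : H.Adj u v) (h' : H.Adj v w) (h'' : H.Adj w z) :
    H.edist u z ≤ 3 :=
  SimpleGraph.edist_triangle.trans
    ((add_le_add (edist_le_one h) (edist_le_two h' h'')).trans (by norm_num))

theorem decodeOuter_vec (ψ : ℝ) (T Z T₁ U₁ U₂ D : Finset V) :
    decodeOuter H X ψ ![T, Z, T₁, U₁, U₂, D] = outer H X ψ (inner H T Z T₁ U₁) U₂ :=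
  rfl

theorem decodeClosure_vec (ψ : ℝ) (T Z T₁ U₁ U₂ D : Finset V) :
    decodeClosure H X Y ψ ![T, Z, T₁, U₁, U₂, D] = univ.filter fun v => H.neighborFinset v ⊆
      fill H Y ψ (inner H T Z T₁ U₁) (outer H X ψ (inner H T Z T₁ U₁) U₂) ∪ D :=
  rfl

omit [Fintype V] in
theorem card_biUnion_six_le (A B C D E F : Finset V) :
    (univ.biUnion ![A, B, C, D, E, F]).card ≤
      A.card + B.card + C.card + D.card + E.card + F.card := by
  refine card_biUnion_le.trans ?_
  rw [Fin.sum_univ_six]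
  exact le_rfl

/-- Every vertex of `A` has a neighbour in `E`, and a vertex of `E` is two steps from `T`, in `T₁`,
or adjacent to `U₁`. The farthest part of the code from `A` is `U₂`, at distance at most 3 by way of
`E`. -/
theorem unsplit_code {A T T₁ U₁ U₂ D E : Finset V} {r : V}
    (hA : IsLinked H 2 A) (hT : T ⊆ nbhd H A) (hT₁ : T₁ ⊆ nbhd H A) (hr : r ∈ T₁)
    (hU₁ : U₁ ⊆ closure H A) (hD : D ⊆ nbhd H A)
    (hE : E = inner H T (nbhd H T \ closure H A) T₁ U₁) (hEA : E ⊆ nbhd H A)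
    (hadj : ∀ u ∈ closure H A, ∃ w ∈ E, H.Adj u w)
    (hU₂ : ∀ w ∈ U₂, ∃ u, H.Adj w u ∧ ∃ z ∈ E, H.Adj u z) :
    Unsplit (ball H 8) r (univ.biUnion ![T, nbhd H T \ closure H A, T₁, U₁, U₂, D]) := by
  set c : Fin 6 → Finset V := ![T, nbhd H T \ closure H A, T₁, U₁, U₂, D] with hc
  have hmem : ∀ i, c i ⊆ univ.biUnion c := fun i => subset_biUnion_of_mem c (mem_univ i)
  have hG : ∀ w ∈ nbhd H A, ∃ v ∈ A, H.Adj w v := by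
    intro w hw
    obtain ⟨v, hv, hvw⟩ := mem_nbhd.1 hw
    exact ⟨v, hv, hvw.symm⟩
  have hG3 : ∀ w ∈ nbhd H A, ∃ v ∈ A, H.edist w v ≤ 3 := by
    intro w hw
    obtain ⟨v, hv, hwv⟩ := hG w hw
    exact ⟨v, hv, (edist_le_one hwv).trans (by norm_num)⟩
  refine unsplit_of_isLinked hA (hmem 2 hr) ?_ ?_
  · intro w hw
    obtain ⟨i, -, hi⟩ := mem_biUnion.1 hw
    fin_cases i
    · exact hG3 w (hT hi)
    · obtain ⟨z, hz, hzw⟩ := mem_nbhd.1 (mem_sdiff.1 (show w ∈ nbhd H T \ closure H A from hi)).1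
      obtain ⟨v, hv, hzv⟩ := hG z (hT hz)
      exact ⟨v, hv, (edist_le_two hzw.symm hzv).trans (by norm_num)⟩
    · exact hG3 w (hT₁ hi)
    · obtain ⟨z, hz, hwz⟩ := hadj w (hU₁ hi)
      obtain ⟨v, hv, hzv⟩ := hG z (hEA hz)
      exact ⟨v, hv, (edist_le_two hwz hzv).trans (by norm_num)⟩
    · obtain ⟨u, hwu, z, hz, huz⟩ := hU₂ w hi
      obtain ⟨v, hv, hzv⟩ := hG z (hEA hz)
      exact ⟨v, hv, edist_le_three hwu huz hzv⟩
    · exact hG3 w (hD hi)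
  · intro v hv
    obtain ⟨z, hz, hvz⟩ := hadj v (subset_closure A hv)
    rw [hE, inner, mem_union, mem_union] at hz
    rcases hz with (hz | hz) | hz
    · obtain ⟨x, hx, hxz⟩ := mem_nbhd.1 hz
      obtain ⟨y, hy, hyx⟩ := mem_nbhd.1 (mem_sdiff.1 hx).1
      exact ⟨y, hmem 0 hy, edist_le_three hvz hxz.symm hyx.symm⟩
    · exact ⟨z, hmem 2 hz, (edist_le_one hvz).trans (by norm_num)⟩
    · obtain ⟨x, hx, hxz⟩ := mem_nbhd.1 hz
      exact ⟨x, hmem 3 hx, (edist_le_two hvz hxz.symm).trans (by norm_num)⟩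

namespace NearRegular

variable (h : NearRegular H X Y δ Δ d)
include h

/-- Every `2`-linked set has a code of one of two kinds. -/
theorem exists_code {A : Finset V} (hA : A ⊆ X) (hlink : IsLinked H 2 A) {t : ℝ}
    (ht : t = ((nbhd H A).card : ℝ) - ((closure H A).card : ℝ))
    (ht0 : 0 ≤ t) (hδ : 0 < δ) (hd : 2 ≤ δ * d) {L c₀ ψ η n : ℝ} (hL : 1 ≤ L)
    (hLd : Real.log d ≤ L) (hc₀ : c₀ = δ ^ 2 / (4 * (max Δ 1 : ℕ))) (hψ0 : 0 < ψ)
    (hψ : ψ ≤ δ * d / 2) (hη : 4 * ψ * t / (δ ^ 2 * d) ≤ η)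
    (hn : 3 * L * (nbhd H A).card / (c₀ * d ^ 2) + 3 * L * t / (c₀ * d) +
      (nbhd H A).card / (d : ℝ) ^ 2 + 1 + 4 * t / (δ * ψ) ≤ n) :
    HasCode H Y (decodeOuter H X ψ) n ((nbhd H A).card - η) A ∨
      HasCode H Y (decodeClosure H X Y ψ) (n + 2 * η) (closure H A).card A := by
  have hd0 : 0 < d := by
    rcases Nat.eq_zero_or_pos d with h0 | h0
    · rw [h0] at hd; norm_num at hd
    · exact h0
  obtain ⟨v₀, hv₀⟩ : A.Nonempty := by
    obtain ⟨v⟩ := hlink.nonempty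
    exact ⟨v, v.2⟩
  obtain ⟨y₀, hvy⟩ := h.exists_adj (by linarith) v₀
  have hy₀ : y₀ ∈ nbhd H A := mem_nbhd.2 ⟨v₀, hv₀, hvy⟩
  have hy₀Y : y₀ ∈ Y := h.nbhd_subset hA hy₀
  obtain ⟨T, hT, T₁, hT₁, hyT₁, hgood, hsize⟩ :=
    h.exists_sample hA ht ht0 hδ hd hy₀ hL hLd hc₀
  obtain ⟨U₁, hU₁, U₂, E, S, F, hE, hS, hF, hU₁c, hU₂c, hEG, hCS, hFG, hSF, hadj, hU₂⟩ :=
    h.exists_approx hA ht hδ hd0 hψ0 hψ hT₁ hgood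
  have hcard : ∀ D : Finset V, ((univ.biUnion
      ![T, nbhd H T \ closure H A, T₁, U₁, U₂, D]).card : ℝ) ≤ n + D.card := by
    intro D
    have h1 : (univ.biUnion ![T, nbhd H T \ closure H A, T₁, U₁, U₂, D]).card ≤
        T.card + (nbhd H T \ closure H A).card + T₁.card + U₁.card + U₂.card + D.card :=
      card_biUnion_six_le _ _ _ _ _ _
    have h2 : 4 * t / (δ * ψ) = 2 * t / δ / ψ + 2 * t / δ / ψ := by
      ring
    have h3 : ((univ.biUnion ![T, nbhd H T \ closure H A, T₁, U₁, U₂, D]).card : ℝ) ≤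
        T.card + (nbhd H T \ closure H A).card + T₁.card + U₁.card + U₂.card + D.card := by
      exact_mod_cast h1
    linarith
  -- If `S` is not small, then `|F| ≥ |S| - η > g - 2η`, and the rest `D` of `N(A)` is cheap to
  -- record.
  by_cases hcase : (S.card : ℝ) ≤ (nbhd H A).card - η
  · refine Or.inl ⟨y₀, hy₀Y, ![T, nbhd H T \ closure H A, T₁, U₁, U₂, ∅],
      unsplit_code hlink hT hT₁ hyT₁ hU₁ (by simp) hE hEG hadj hU₂, by simpa using hcard ∅, ?_, ?_⟩
    all_goals
      have hdec : decodeOuter H X ψ ![T, nbhd H T \ closure H A, T₁, U₁, U₂, ∅] = S := by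
        rw [decodeOuter_vec, hS, hE]
      rw [hdec]
    · exact (subset_closure A).trans hCS
    · exact hcase
  · right
    set D := nbhd H A \ F with hD
    have hDcard : (D.card : ℝ) ≤ 2 * η := by
      have h1 := card_sdiff_add_card_eq_card hFG
      have h2 : (D.card : ℝ) + F.card = (nbhd H A).card := by exact_mod_cast h1
      linarith
    have hdec : decodeClosure H X Y ψ ![T, nbhd H T \ closure H A, T₁, U₁, U₂, D] =
        closure H A := by
      have h1 : fill H Y ψ (inner H T (nbhd H T \ closure H A) T₁ U₁)
          (outer H X ψ (inner H T (nbhd H T \ closure H A) T₁ U₁) U₂) ∪ D = nbhd H A := by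
        rw [← hE, ← hS, ← hF, hD]
        exact union_sdiff_of_subset hFG
      rw [decodeClosure_vec, h1]
      rfl
    refine ⟨y₀, hy₀Y, ![T, nbhd H T \ closure H A, T₁, U₁, U₂, D],
      unsplit_code hlink hT hT₁ hyT₁ hU₁ sdiff_subset hE hEG hadj hU₂,
      (hcard D).trans (by linarith), ?_, ?_⟩
    · rw [hdec]; exact subset_closure A
    · rw [hdec]

end NearRegular

/-! ### Numerical estimates. -/

/-- The number of sets with a code, in terms of the binary logarithm `L` of `d`. -/
theorem card_le_of_hasCode (hd : ∀ v, H.degree v ≤ d) (hd2 : 2 ≤ d) {L : ℝ}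
    (hL : L = Real.logb 2 d) (fam : Finset (Finset V)) (dec : (Fin 6 → Finset V) → Finset V)
    {n b : ℝ} (hn : 0 ≤ n) (hb : 0 ≤ b) (hfam : ∀ A ∈ fam, HasCode H Y dec n b A) :
    (fam.card : ℝ) ≤ Y.card * (2 : ℝ) ^ (40 * L * n + b) := by
  have hd2' : (2 : ℝ) ≤ d := by exact_mod_cast hd2
  have hL0 : 0 ≤ L := hL ▸ Real.logb_nonneg (by norm_num) (by linarith)
  have hdL : (2 : ℝ) ^ L = d := by
    rw [hL]; exact Real.rpow_logb (by norm_num) (by norm_num) (by linarith)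
  have h1 := card_le_of_codes H hd Y fam ⌊n⌋₊ dec b hb (by
    intro A hA
    obtain ⟨r, hr, c, hc1, hc2, hc3, hc4⟩ := hfam A hA
    exact ⟨r, hr, c, hc1, Nat.le_floor hc2, hc3, hc4⟩)
  refine h1.trans ?_
  rw [Real.rpow_add (by norm_num), ← mul_assoc (Y.card : ℝ) ((2 : ℝ) ^ (40 * L * n))]
  refine mul_le_mul_of_nonneg_right (mul_le_mul_of_nonneg_left ?_ (Nat.cast_nonneg _))
    (by positivity)
  set k := ⌊n⌋₊ with hk
  have hkn : (k : ℝ) ≤ n := Nat.floor_le hn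
  have h2 : ((d : ℝ) + 1) ≤ (d : ℝ) ^ 2 := by nlinarith
  -- With `d + 1 ≤ d²` and `2 ≤ d` the exponent of `d` is `32k + 6k = 38k`, rounded up to `40`.
  calc (((d : ℝ) + 1) ^ 8) ^ (2 * k) * (2 ^ k) ^ 6
      ≤ (((d : ℝ) ^ 2) ^ 8) ^ (2 * k) * ((d : ℝ) ^ k) ^ 6 := by gcongr
    _ = (d : ℝ) ^ (38 * k) := by
      rw [← pow_mul, ← pow_mul, ← pow_mul, ← pow_add]; congr 1; ring
    _ = (2 : ℝ) ^ (L * (38 * k : ℕ)) := by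
      rw [Real.rpow_mul (by norm_num), hdL, Real.rpow_natCast]
    _ ≤ (2 : ℝ) ^ (40 * L * n) := by
      refine Real.rpow_le_rpow_of_exponent_le (by norm_num) ?_
      push_cast
      have : L * k ≤ L * n := by gcongr
      nlinarith [mul_nonneg hL0 hn]

theorem eventually_mul_logb_sq_le_sqrt (M : ℝ) (hM : 0 < M) :
    ∃ d₀ : ℕ, ∀ d : ℕ, d₀ ≤ d → M * Real.logb 2 (d : ℝ) ^ 2 ≤ √(d : ℝ) := by
  have h1 := ((Real.isLittleO_pow_log_id_atTop (n := 4)).comp_tendsto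
    (tendsto_natCast_atTop_atTop (R := ℝ))).def
      (show 0 < Real.log 2 ^ 4 / M ^ 2 by have := Real.log_pos one_lt_two; positivity)
  obtain ⟨d₀, hd₀⟩ := Filter.eventually_atTop.1 h1
  refine ⟨d₀, fun d hd => Real.le_sqrt_of_sq_le ?_⟩
  have h2 := hd₀ d hd
  have hl : 0 < Real.log 2 := Real.log_pos one_lt_two
  simp only [Function.comp_apply, id_eq, Real.norm_eq_abs, Nat.abs_cast] at h2
  have h3 := (le_abs_self _).trans h2
  rw [Real.logb]
  have h4 : (M * (Real.log d / Real.log 2) ^ 2) ^ 2 =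
      M ^ 2 / Real.log 2 ^ 4 * Real.log d ^ 4 := by field_simp
  rw [h4]
  calc M ^ 2 / Real.log 2 ^ 4 * Real.log d ^ 4
      ≤ M ^ 2 / Real.log 2 ^ 4 * (Real.log 2 ^ 4 / M ^ 2 * d) := by gcongr
    _ = (d : ℝ) := by field_simp

/-- The code lengths that occur are negligible. -/
theorem code_length_le {δ c₀ d L K t g : ℝ} (hδ : 0 < δ) (hδ1 : δ ≤ 1) (hc₀ : 0 < c₀)
    (hL : 1 ≤ L) (hd : 0 < d) (hlarge : (1024000 / δ ^ 2 + 768000 / c₀) * L ^ 2 ≤ √d)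
    (hK : K = 768000 / c₀ + 256000) (ht : K * L ^ 2 ≤ t) (hg : K * (g * L ^ 3 / d ^ 2) ≤ t)
    (hg0 : 0 ≤ g) :
    3 * L * g / (c₀ * d ^ 2) + 3 * L * t / (c₀ * d) + g / d ^ 2 + 1 + 4 * t / (δ * √d) ≤
      t / (51200 * L ^ 2) := by
  have hs : 0 < √d := Real.sqrt_pos.2 hd
  have hss : √d * √d = d := Real.mul_self_sqrt hd.le
  have hL2 : 1 ≤ L ^ 2 := one_le_pow₀ hL
  have hKpos : 0 < K := by rw [hK]; positivity
  have ht0 : 0 < t := lt_of_lt_of_le (by positivity) ht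
  have hx : 0 ≤ g * L ^ 3 / d ^ 2 := by positivity
  have hA : 768000 / c₀ * (g * L ^ 3 / d ^ 2) ≤ t :=
    le_trans (mul_le_mul_of_nonneg_right (by rw [hK]; linarith) hx) hg
  have hB : 256000 * (g * L ^ 3 / d ^ 2) ≤ t := by
    have : 0 < 768000 / c₀ := by positivity
    exact le_trans (mul_le_mul_of_nonneg_right (by rw [hK]; linarith) hx) hg
  have hC : 256000 * L ^ 2 ≤ t := by
    have : 0 < 768000 / c₀ := by positivity
    exact le_trans (mul_le_mul_of_nonneg_right (by rw [hK]; linarith) (by positivity)) ht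
  have hD : 768000 / c₀ * L ^ 2 ≤ √d := by
    have : 0 ≤ 1024000 / δ ^ 2 * L ^ 2 := by positivity
    linarith [add_mul (1024000 / δ ^ 2) (768000 / c₀) (L ^ 2)]
  have hE : 1024000 / δ ^ 2 * L ^ 2 ≤ √d := by
    have : 0 ≤ 768000 / c₀ * L ^ 2 := by positivity
    linarith [add_mul (1024000 / δ ^ 2) (768000 / c₀) (L ^ 2)]
  have hLs : L ≤ √d := by
    have h1 : (1 : ℝ) ≤ 1024000 / δ ^ 2 := by
      rw [le_div_iff₀ (by positivity)]
      have : δ ^ 2 ≤ 1 := pow_le_one₀ hδ.le hδ1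
      linarith
    have h2 : L ^ 2 ≤ 1024000 / δ ^ 2 * L ^ 2 := le_mul_of_one_le_left (by positivity) h1
    nlinarith
  -- Each of the five terms is at most one fifth of the bound: `256000 = 5 * 51200`.
  have e1 : 3 * L * g / (c₀ * d ^ 2) ≤ t / (256000 * L ^ 2) := by
    rw [le_div_iff₀ (by positivity)]
    calc 3 * L * g / (c₀ * d ^ 2) * (256000 * L ^ 2)
        = 768000 / c₀ * (g * L ^ 3 / d ^ 2) := by field_simp; ring
      _ ≤ t := hA
  have e2 : 3 * L * t / (c₀ * d) ≤ t / (256000 * L ^ 2) := by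
    rw [le_div_iff₀ (by positivity)]
    have h1 : 768000 / c₀ * L ^ 2 * L ≤ √d * √d := by gcongr
    calc 3 * L * t / (c₀ * d) * (256000 * L ^ 2)
        = t * (768000 / c₀ * L ^ 2 * L) / d := by field_simp; ring
      _ ≤ t * (√d * √d) / d := by gcongr
      _ = t := by rw [hss]; field_simp
  have e3 : g / d ^ 2 ≤ t / (256000 * L ^ 2) := by
    rw [le_div_iff₀ (by positivity)]
    calc g / d ^ 2 * (256000 * L ^ 2) = 256000 * (g * L ^ 2 / d ^ 2) := by ring
      _ ≤ 256000 * (g * L ^ 3 / d ^ 2) := by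
        gcongr 256000 * (g * ?_ / d ^ 2)
        exact pow_le_pow_right₀ hL (by norm_num)
      _ ≤ t := hB
  have e4 : 1 ≤ t / (256000 * L ^ 2) := by
    rw [le_div_iff₀ (by positivity)]; linarith
  have e5 : 4 * t / (δ * √d) ≤ t / (256000 * L ^ 2) := by
    rw [le_div_iff₀ (by positivity)]
    have h1 : 1024000 / δ * L ^ 2 ≤ √d := by
      refine le_trans ?_ hE
      gcongr
      rw [sq]; exact mul_le_of_le_one_left hδ.le hδ1
    calc 4 * t / (δ * √d) * (256000 * L ^ 2) = t * (1024000 / δ * L ^ 2) / √d := by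
          field_simp; ring
      _ ≤ t * √d / √d := by gcongr
      _ = t := by field_simp
  have e6 : t / (51200 * L ^ 2) = 5 * (t / (256000 * L ^ 2)) := by field_simp; norm_num
  linarith


/-- Codes of the two kinds together are cheap enough. -/
theorem two_code_bounds_le {y a g t L n η : ℝ} (hy : 0 ≤ y) (hL : 1 ≤ L) (ht : t = g - a)
    (htL : 256000 * L ^ 2 ≤ t) (hn : n = t / (51200 * L ^ 2)) (hη : η = t / (320 * L)) :
    y * (2 : ℝ) ^ (40 * L * n + (g - η)) + y * (2 : ℝ) ^ (40 * L * (n + 2 * η) + a) ≤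
      y * (2 : ℝ) ^ (g - 1 / 640 * (g - a) / L) := by
  have hx : 256000 * L ≤ t / L := by rw [le_div_iff₀ (by linarith)]; linarith
  have hxt : t / L ≤ t := div_le_self (by nlinarith) hL
  have h1 : 40 * L * n = t / L / 1280 := by rw [hn]; field_simp; ring
  have h2 : η = t / L / 320 := by rw [hη]; field_simp
  have h3 : 40 * L * (2 * η) = t / 4 := by rw [hη]; field_simp; ring
  set z := g - 1 / 640 * (g - a) / L with hz
  -- The exponents are `g - 3t/(1280L)` and `g - 3t/4 + t/(1280L)`. Both are at most `z - 1`, and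
  -- the spare factor 2 absorbs the sum of two terms.
  have h4 : z = g - t / L / 640 := by rw [hz, ← ht]; ring
  have h5 : (2 : ℝ) ^ (40 * L * n + (g - η)) ≤ 2 ^ (z - 1) :=
    Real.rpow_le_rpow_of_exponent_le (by norm_num) (by rw [h1, h2, h4]; linarith)
  have h6 : (2 : ℝ) ^ (40 * L * (n + 2 * η) + a) ≤ 2 ^ (z - 1) :=
    Real.rpow_le_rpow_of_exponent_le (by norm_num) (by
      rw [mul_add, h1, h3, h4]; linarith)
  have h7 : (2 : ℝ) ^ (z - 1) = 2 ^ z / 2 := by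
    rw [Real.rpow_sub (by norm_num), Real.rpow_one]
  rw [h7] at h5 h6
  nlinarith

end GraphContainer

/-! ### Choice of parameters and conclusion. -/

theorem lemma4p1 :
    ∃ γ : ℝ, 0 < γ ∧
      ∀ (δ : ℝ), 0 < δ → δ ≤ 1 → ∀ Δ : ℕ,
        ∃ (K : ℝ) (d₀ : ℕ), 0 < K ∧
          ∀ (V : Type*) [Fintype V] [DecidableEq V] (G : SimpleGraph V) [DecidableRel G.Adj]
            (X Y : Finset V) (d : ℕ),
            d₀ ≤ d →
            G.IsBipartiteWith (X : Set V) (Y : Set V) →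
            X ∪ Y = Finset.univ →
            (∀ v : V, δ * (d : ℝ) ≤ (G.degree v : ℝ) ∧ G.degree v ≤ d) →
            (∀ v ∈ X, ∀ w ∈ Y, G.Adj v w → G.degree w ≤ G.degree v) →
            (∀ v w : V, v ≠ w → (G.neighborFinset v ∩ G.neighborFinset w).card ≤ Δ) →
            ∀ a g : ℕ,
              K * ((g : ℝ) * Real.logb 2 (d : ℝ) ^ 3 / (d : ℝ) ^ 2) ≤ (g : ℝ) - (a : ℝ) →
              K * Real.logb 2 (d : ℝ) ^ 2 ≤ (g : ℝ) - (a : ℝ) →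
              ((GraphContainer.family G X a g).card : ℝ) ≤
                (Y.card : ℝ) *
                  (2 : ℝ) ^ ((g : ℝ) - γ * ((g : ℝ) - (a : ℝ)) / Real.logb 2 (d : ℝ)) := by
  refine ⟨1 / 640, by norm_num, fun δ hδ hδ1 Δ => ?_⟩
  have hM : (0 : ℝ) < (max Δ 1 : ℕ) := by
    exact_mod_cast lt_of_lt_of_le Nat.one_pos (le_max_right Δ 1)
  obtain ⟨c₀, hc₀⟩ : ∃ c₀ : ℝ, c₀ = δ ^ 2 / (4 * (max Δ 1 : ℕ)) := ⟨_, rfl⟩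
  have hc₀0 : 0 < c₀ := by rw [hc₀]; positivity
  obtain ⟨d₁, hd₁⟩ := GraphContainer.eventually_mul_logb_sq_le_sqrt
    (1024000 / δ ^ 2 + 768000 / c₀) (by positivity)
  refine ⟨768000 / c₀ + 256000, max d₁ 2, by positivity, ?_⟩
  intro V _ _ G _ X Y d hd hbip hcover hdeg hmono hcodeg a g hg ht
  have h : GraphContainer.NearRegular G X Y δ Δ d :=
    ⟨hbip, hcover, fun v => (hdeg v).1, fun v => (hdeg v).2, hmono, hcodeg⟩
  have hd2 : 2 ≤ d := (le_max_right _ _).trans hd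
  have hd2' : (2 : ℝ) ≤ d := by exact_mod_cast hd2
  have hlarge := hd₁ d ((le_max_left _ _).trans hd)
  obtain ⟨L, hLdef⟩ : ∃ L : ℝ, L = Real.logb 2 d := ⟨_, rfl⟩
  rw [← hLdef] at hlarge hg ht ⊢
  have hL : 1 ≤ L := by
    rw [hLdef, Real.le_logb_iff_rpow_le (by norm_num) (by linarith), Real.rpow_one]
    exact hd2'
  have hLd : Real.log d ≤ L := by
    have h1 : 0 ≤ Real.log d := Real.log_nonneg (by linarith)
    rw [hLdef, Real.logb, le_div_iff₀ (Real.log_pos one_lt_two)]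
    exact mul_le_of_le_one_right h1 (Real.log_two_lt_d9.le.trans (by norm_num))
  obtain ⟨t, htdef⟩ : ∃ t : ℝ, t = (g : ℝ) - a := ⟨_, rfl⟩
  rw [← htdef] at hg ht
  have hL2 : 1 ≤ L ^ 2 := one_le_pow₀ hL
  have hpos : 0 < 768000 / c₀ := by positivity
  have htL : 256000 * L ^ 2 ≤ t := by nlinarith
  have ht0 : 0 < t := by linarith
  have hd0 : (0 : ℝ) < d := by linarith
  have hss : √(d : ℝ) * √(d : ℝ) = d := Real.mul_self_sqrt hd0.le
  have hs0 : 0 < √(d : ℝ) := Real.sqrt_pos.2 hd0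
  have hsL : 1024000 / δ ^ 2 * L ^ 2 ≤ √(d : ℝ) := by nlinarith
  have hs_delta : 1024000 * L ^ 2 ≤ √(d : ℝ) * δ ^ 2 := by
    rwa [div_mul_eq_mul_div, div_le_iff₀ (by positivity)] at hsL
  have hδ2 : δ ^ 2 ≤ δ := by nlinarith
  have hsδ : 4 ≤ δ * √(d : ℝ) := by nlinarith
  have hs2 : 2 ≤ √(d : ℝ) := by nlinarith
  -- The threshold `ψ = √d` makes both the greedy families, of size `4t/(δψ)`, and the discrepancy
  -- `4ψt/(δ²d)` of order `t/√d`.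
  have hψ : √(d : ℝ) ≤ δ * d / 2 := by
    have : δ * d = δ * √(d : ℝ) * √(d : ℝ) := by rw [mul_assoc, hss]
    nlinarith
  -- `η` must exceed the code cost `40Ln = t/(1280L)`, while recording `2η` vertices, at `40L` bits
  -- each, must cost less than `t`.
  obtain ⟨η, hη⟩ : ∃ η : ℝ, η = t / (320 * L) := ⟨_, rfl⟩
  obtain ⟨n, hn⟩ : ∃ n : ℝ, n = t / (51200 * L ^ 2) := ⟨_, rfl⟩
  have hη0 : 0 ≤ η := by rw [hη]; positivity
  have hn0 : 0 ≤ n := by rw [hn]; positivity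
  have hηt : η ≤ t := by rw [hη]; exact div_le_self ht0.le (by linarith)
  have hψη : 4 * √(d : ℝ) * t / (δ ^ 2 * d) ≤ η := by
    rw [hη, div_le_div_iff₀ (by positivity) (by positivity)]
    have h1 : 1280 * L ≤ √(d : ℝ) * δ ^ 2 := by nlinarith
    calc 4 * √(d : ℝ) * t * (320 * L) = t * √(d : ℝ) * (1280 * L) := by ring
      _ ≤ t * √(d : ℝ) * (√(d : ℝ) * δ ^ 2) := by gcongr
      _ = t * (δ ^ 2 * (√(d : ℝ) * √(d : ℝ))) := by ring
      _ = t * (δ ^ 2 * d) := by rw [hss]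
  have hlen := GraphContainer.code_length_le hδ hδ1 hc₀0 hL hd0 hlarge rfl ht hg
    (Nat.cast_nonneg g)
  rw [← hn] at hlen
  classical
  set fam := GraphContainer.family G X a g with hfam
  have hcode : ∀ A ∈ fam,
      GraphContainer.HasCode G Y (GraphContainer.decodeOuter G X √(d : ℝ)) n (g - η) A ∨
        GraphContainer.HasCode G Y (GraphContainer.decodeClosure G X Y √(d : ℝ))
          (n + 2 * η) a A := by
    intro A hA
    obtain ⟨hAX, hlink, hAa, hAg⟩ := Finset.mem_filter.1 hA
    have := h.exists_code (Finset.mem_powerset.1 hAX) hlink (t := t) (by rw [hAa, hAg, htdef])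
      ht0.le hδ (by linarith) hL hLd hc₀ hs0 hψ hψη (n := n) (by rwa [hAg])
    rwa [hAa, hAg] at this
  obtain ⟨P, hP⟩ : ∃ P : Finset V → Prop, P = GraphContainer.HasCode G Y
    (GraphContainer.decodeOuter G X √(d : ℝ)) n (g - η) := ⟨_, rfl⟩
  have hsplit : (fam.card : ℝ) = (fam.filter P).card + (fam.filter fun A => ¬ P A).card := by
    exact_mod_cast (Finset.card_filter_add_card_filter_not (s := fam) P).symm
  have h1 := GraphContainer.card_le_of_hasCode h.upper hd2 hLdef (fam.filter P) _ hn0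
    (b := g - η) (by have : (0 : ℝ) ≤ a := Nat.cast_nonneg a; linarith)
    (fun A hA => by
      have := (Finset.mem_filter.1 hA).2
      rwa [hP] at this)
  have h2 := GraphContainer.card_le_of_hasCode h.upper hd2 hLdef (fam.filter fun A => ¬ P A)
    (GraphContainer.decodeClosure G X Y √(d : ℝ)) (n := n + 2 * η) (by linarith) (b := a)
    (Nat.cast_nonneg a) (fun A hA => by
      obtain ⟨hA1, hA2⟩ := Finset.mem_filter.1 hA
      rw [hP] at hA2
      exact (hcode A hA1).resolve_left hA2)
  rw [hsplit]
  exact (add_le_add h1 h2).trans (GraphContainer.two_code_bounds_le (Nat.cast_nonneg _) hL htdef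
    htL hn hη)
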